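/- Let $H\neq\{0\}$ be a complex Hilbert space, $(K,[\cdot,\cdot])$ a Pontryagin space (a Krein space whose inner product has finitely many negative squares), $A$ a bounded self-adjoint operator in $K$, and $\Gamma_0:H\to K$ a bounded operator; define $\Gamma_0^+:K\to H$ by $(h,\Gamma_0^+k)=[\Gamma_0h,k]$. Let $Q$ be a generalized Nevanlinna function in $N_\kappa(H)$, that is, $Q$ is an $L(H)$-valued function, meromorphic in $\mathbb C\setminus\mathbb R$, with $Q(\bar z)^*=Q(z)$, whose kernel $\frac{Q(z)-Q(w)^*}{z-\bar w}$ has $\kappa$ negative squares on its domain in $\mathbb C^+$. Assume that \[ Q(z)=\Gamma_0^+(A-z)^{-1}\Gamma_0 \] and that $\Gamma_0^+\Gamma_0$ is boundedly invertible. Put $\hat Q(z):=-Q(z)^{-1}$, and let $(\hat K,\hat A,\hat\Gamma)$ be a triplet representing $\hat Q$: $\hat K$ is a Pontryagin space, $\hat A$ a self-adjoint linear relation in $\hat K$, $\hat\Gamma:H\to\hat K$ a bounded operator, $z_0\in\rho(\hat A)\cap\mathbb C^+$ a point of the domain of $\hat Q$, and \[ \hat Q(z)=\hat Q(z_0)^*+(z-\bar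 z_0)\,\hat\Gamma^+\bigl(I+(z-z_0)(\hat A-z)^{-1}\bigr)\hat\Gamma . \] Then the linear relation $\hat A$ is not an operator, and there is a closed subspace $\hat K_1\subseteq\hat K$, invariant with respect to $\hat A$ (that is, $(\hat A-z)^{-1}\hat K_1\subseteq\hat K_1$ for all $z\in\rho(\hat A)$), whose negative index (the maximal dimension of a subspace of $\hat K_1$ on which $[\cdot,\cdot]$ is negative definite) equals the number of negative eigenvalues of $(\Gamma_0^+\Gamma_0)^{-1}$, counted with multiplicity. If the representation is minimal, i.e. $\hat K$ is the closed linear span of the vectors $(I+(z-z_0)(\hat A-z)^{-1})\hat\Gamma h$ with $z\in\rho(\hat A)$, $h\in H$, then $\hat K_1$ can be chosen such that, in addition, it is non-degenerate and $y\in\hat K_1$ whenever $x\in\hat K_1$ and $(x,y)\in\hat A$. -/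

import Mathlib

open scoped Topology ComplexConjugate

namespace PontryaginRep

noncomputable section

set_option linter.unusedSectionVars false

variable {H K : Type*}
  [NormedAddCommGroup H] [InnerProductSpace ℂ H] [CompleteSpace H]
  [NormedAddCommGroup K] [InnerProductSpace ℂ K] [CompleteSpace K]

/-- The indefinite inner product `[x, y] = (J x, y)` on `K` induced by `J`. As everywhere in
Mathlib, it is conjugate-linear in the first and linear in the second variable. -/
def form (J : K →L[ℂ] K) (x y : K) : ℂ := inner ℂ (J x) y

/-- `J` is a fundamental symmetry (`J = J*`, `J² = 1`) with finite-dimensional negative part, so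
that `(K, [·,·])` with `[x, y] = (J x, y)` is a Pontryagin space, i.e. a Krein space whose inner
product has finitely many negative squares. -/
structure IsPontryagin (J : K →L[ℂ] K) : Prop where
  isSelfAdjoint : IsSelfAdjoint J
  sq_eq_one : J * J = 1
  finiteDimensional : FiniteDimensional ℂ (Module.End.eigenspace (J : K →ₗ[ℂ] K) (-1))

/-- The operator `Γ⁺ : K → H` with `(h, Γ⁺ k) = [Γ h, k]`, for a bounded operator `Γ : H → K`. -/
def plusAdjoint (J : K →L[ℂ] K) (Γ : H →L[ℂ] K) : K →L[ℂ] H :=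
  (ContinuousLinearMap.adjoint Γ).comp (ContinuousLinearMap.adjoint J)

theorem inner_plusAdjoint (J : K →L[ℂ] K) (Γ : H →L[ℂ] K) (h : H) (k : K) :
    inner ℂ h (plusAdjoint J Γ k) = form J (Γ h) k := by
  simp [plusAdjoint, form, ContinuousLinearMap.adjoint_inner_right]

/-- A bounded operator is self-adjoint with respect to `[·,·]`. -/
def IsSelfAdjointOp (J A : K →L[ℂ] K) : Prop :=
  ∀ x y : K, form J (A x) y = form J x (A y)

/-- The negative index (number of negative squares of `[·,·]`) of a subspace `L`: the supremum of
the dimensions of the subspaces of `L` on which `[·,·]` is negative definite. -/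
def negIndex (J : K →L[ℂ] K) (L : Submodule ℂ K) : ℕ∞ :=
  ⨆ (N : Submodule ℂ K) (_ : N ≤ L) (_ : ∀ x ∈ N, x ≠ 0 → (form J x x).re < 0),
    (Module.rank ℂ N).toENat

/-- `L` is non-degenerate: no non-zero vector of `L` is orthogonal to all of `L`. -/
def IsNondegenerate (J : K →L[ℂ] K) (L : Submodule ℂ K) : Prop :=
  ∀ x ∈ L, (∀ y ∈ L, form J x y = 0) → x = 0

/-- The number of negative eigenvalues, counted with multiplicity, of an operator in `H`: the
dimension of the sum (which is automatically direct) of all eigenspaces to negative eigenvalues. -/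
def numNegEigenvalues (T : H →L[ℂ] H) : ℕ∞ :=
  (Module.rank ℂ
    (⨆ (t : ℝ) (_ : t < 0), Module.End.eigenspace (T : H →ₗ[ℂ] H) (t : ℂ) :
      Submodule ℂ H)).toENat

/-! ### Linear relations -/

/-- A linear relation in `K` is a linear subspace of `K × K`; `(x, y) ∈ A` means `y ∈ A x`. -/
abbrev LinRel (K : Type*) [AddCommGroup K] [Module ℂ K] := Submodule ℂ (K × K)

/-- The relation is (the graph of) an operator, i.e. single-valued. -/
def IsOperator (A : LinRel K) : Prop :=
  ∀ x y y' : K, (x, y) ∈ A → (x, y') ∈ A → y = y'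

/-- `A = A^[*]`, where `(u, v) ∈ A^[*]` iff `[y, u] = [x, v]` for all `(x, y) ∈ A`. -/
def IsSelfAdjointRel (J : K →L[ℂ] K) (A : LinRel K) : Prop :=
  ∀ u v : K, (u, v) ∈ A ↔ ∀ x y : K, (x, y) ∈ A → form J y u = form J x v

/-- The relation `(A - z)⁻¹ = {(y - z x, x) : (x, y) ∈ A}` is the graph of the bounded, everywhere
defined operator `B`. -/
def IsResolventAt (A : LinRel K) (z : ℂ) (B : K →L[ℂ] K) : Prop :=
  ∀ u x : K, (x, u + z • x) ∈ A ↔ B u = x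

/-- The resolvent set `ρ(A)` of a linear relation. -/
def resSet (A : LinRel K) : Set ℂ := {z | ∃ B : K →L[ℂ] K, IsResolventAt A z B}

open Classical in
/-- The resolvent operator `(A - z)⁻¹` for `z ∈ ρ(A)` (and `0` otherwise). -/
def res (A : LinRel K) (z : ℂ) : K →L[ℂ] K :=
  if h : ∃ B : K →L[ℂ] K, IsResolventAt A z B then h.choose else 0

theorem res_spec {A : LinRel K} {z : ℂ} (hz : z ∈ resSet A) : IsResolventAt A z (res A z) := by
  have h : ∃ B : K →L[ℂ] K, IsResolventAt A z B := hz
  rw [res, dif_pos h]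
  exact h.choose_spec

/-- `L` is invariant with respect to the relation `A`: all resolvent operators map `L` into
itself. -/
def IsInvariant (A : LinRel K) (L : Submodule ℂ K) : Prop :=
  ∀ z ∈ resSet A, ∀ x ∈ L, res A z x ∈ L

/-! ### Generalized Nevanlinna functions and their representations -/

/-- The matrix `((N_Q(z_i, z_j) h_i, h_j))_{i,j}` of the Nevanlinna kernel
`N_Q(z, w) = (Q(z) - Q(w)*) / (z - conj w)`; here `(·,·)` is linear in the first variable. -/
def nevMatrix (Q : ℂ → H →L[ℂ] H) {n : ℕ} (z : Fin n → ℂ) (h : Fin n → H) :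
    Matrix (Fin n) (Fin n) ℂ :=
  Matrix.of fun i j =>
    inner ℂ (h j)
      (((z i - conj (z j))⁻¹ • (Q (z i) - ContinuousLinearMap.adjoint (Q (z j)))) (h i))

/-- `Q`, with domain `D`, belongs to the class `N_κ(H)` of generalized Nevanlinna functions.
(The nonreal part of `D` may be any set of points of holomorphy of `Q` whose complement is
discrete in `ℂ \ ℝ`. The values of `Q` outside `D` are irrelevant.) -/
structure IsGenNevanlinna (κ : ℕ) (D : Set ℂ) (Q : ℂ → H →L[ℂ] H) : Prop where
  meromorphic : MeromorphicOn Q {z | z.im ≠ 0}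
  analytic : ∀ z ∈ D, z.im ≠ 0 → AnalyticAt ℂ Q z
  codiscrete : ∀ z : ℂ, z.im ≠ 0 → ∀ᶠ w in 𝓝[≠] z, w ∈ D
  symm : ∀ z ∈ D, conj z ∈ D ∧ ContinuousLinearMap.adjoint (Q (conj z)) = Q z
  at_most : ∀ (n : ℕ) (z : Fin n → ℂ) (h : Fin n → H), (∀ i, z i ∈ D ∧ 0 < (z i).im) →
    ∃ hM : (nevMatrix Q z h).IsHermitian,
      (Finset.univ.filter fun i => hM.eigenvalues i < 0).card ≤ κ
  exact : ∃ (n : ℕ) (z : Fin n → ℂ) (h : Fin n → H), (∀ i, z i ∈ D ∧ 0 < (z i).im) ∧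
    ∃ hM : (nevMatrix Q z h).IsHermitian,
      (Finset.univ.filter fun i => hM.eigenvalues i < 0).card = κ

/-- The triplet `(K, A, Γ)` represents `Q` (with domain `D`), with reference point `z₀`:
`Q(z) = Q(z₀)* + (z - conj z₀) Γ⁺ (I + (z - z₀)(A - z)⁻¹) Γ`, where `A` is a self-adjoint linear
relation in the Pontryagin space `K` and `z₀ ∈ ρ(A) ∩ ℂ⁺`. Minimality is not part of this. -/
structure IsRepresentation (D : Set ℂ) (Q : ℂ → H →L[ℂ] H)
    (J : K →L[ℂ] K) (A : LinRel K) (Γ : H →L[ℂ] K) (z₀ : ℂ) : Prop where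
  isPontryagin : IsPontryagin J
  isSelfAdjointRel : IsSelfAdjointRel J A
  mem_resSet : z₀ ∈ resSet A
  im_pos : 0 < z₀.im
  mem_dom : z₀ ∈ D
  eq : ∀ z ∈ D, z ∈ resSet A →
    Q z = ContinuousLinearMap.adjoint (Q z₀) +
      (z - conj z₀) • (plusAdjoint J Γ).comp ((1 + (z - z₀) • res A z).comp Γ)

/-- Minimality of a representation:
`K` is the closed linear span of `(I + (z - z₀)(A - z)⁻¹) Γ h`, `z ∈ ρ(A)`, `h ∈ H`. -/
def IsMinimal (A : LinRel K) (Γ : H →L[ℂ] K) (z₀ : ℂ) : Prop :=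
  (Submodule.span ℂ {k : K | ∃ z ∈ resSet A, ∃ h : H,
    k = (1 + (z - z₀) • res A z) (Γ h)}).topologicalClosure = ⊤

/-- The domain of `Q̂(z) = -Q(z)⁻¹`: the points of the domain of `Q` at which `Q(z)` is boundedly
invertible. -/
def invDom (D : Set ℂ) (Q : ℂ → H →L[ℂ] H) : Set ℂ := {z ∈ D | IsUnit (Q z)}

/-- The function `Q̂(z) = -Q(z)⁻¹`. -/
def negInv (Q : ℂ → H →L[ℂ] H) (z : ℂ) : H →L[ℂ] H := -Ring.inverse (Q z)

end

end PontryaginRep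

namespace PontryaginRep

set_option linter.unusedSectionVars false

variable {H K K' : Type*}
  [NormedAddCommGroup H] [InnerProductSpace ℂ H] [CompleteSpace H]
  [NormedAddCommGroup K] [InnerProductSpace ℂ K] [CompleteSpace K]
  [NormedAddCommGroup K'] [InnerProductSpace ℂ K'] [CompleteSpace K']

/-! ### The indefinite inner product -/

section Form

variable {J : K →L[ℂ] K}

/-! As `A` is bounded, Q(z) behaves like -z⁻¹S at infinity, where S = Γ₀⁺Γ₀, so Q̂(z) grows like zT
with T = S⁻¹ (`negInv_asymptotics`). This linear growth is the trace of a multivalued part of Â. To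
find it, let e_z h = (I + (z - z₀)(Â - z)⁻¹)Γ̂h, let M be the closed span of these defect vectors
and O the isotropic part of M. The representation of Q̂ gives [Γ̂g, e_z h] → (g, Th) as z → ∞. By
the resolvent identity [e_w g, e_z h] has the same limit, and [e_z h, e_z h] stays bounded along
suitable points z_n near the positive imaginary axis. Such points can be chosen in ρ(Â), because
only finitely many points of the upper half-plane lie outside it (`finite_upper_diff_resSet`).

In a Pontryagin space these two facts give weak limits modulo the isotropic part
(`exists_form_limit`), hence vectors p h in M with [e_w g, p h] = [p g, p h] = (g, Th). Since (Â -
v)⁻¹e_z = (e_z - e_v)/(z - v) for z ≠ v, every resolvent sends p h into O (`exists_limit_vectors`).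
The subspace sought is `multivaluedPart`, the vectors of M that all resolvents send into O. On it x
↦ SΓ̂⁺x maps onto H, p is a section, and x - p(SΓ̂⁺x) lies in O. So the form becomes (h, Th), whose
negative index is the number of negative eigenvalues of T
(`IsPontryagin.negIndex_eq_numNegEigenvalues`).

If Â were an operator, its resolvent would be injective, hence bijective on the finite-dimensional
space O. Then p h would lie in O, which forces h = 0. Under minimality O = 0 and the subspace is
exactly Â(0). -/

theorem form_add_left (x y z : K) : form J (x + y) z = form J x z + form J y z := by
  simp [form]

theorem form_add_right (x y z : K) : form J x (y + z) = form J x y + form J x z := by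
  simp [form]

theorem form_sub_left (x y z : K) : form J (x - y) z = form J x z - form J y z := by
  simp [form]

theorem form_sub_right (x y z : K) : form J x (y - z) = form J x y - form J x z := by
  simp [form]

theorem form_smul_left (c : ℂ) (x y : K) : form J (c • x) y = conj c * form J x y := by
  simp [form, mul_comm]

theorem form_smul_right (c : ℂ) (x y : K) : form J x (c • y) = c * form J x y := by
  simp [form]

@[simp] theorem form_zero_left (x : K) : form J 0 x = 0 := by simp [form]

@[simp] theorem form_zero_right (x : K) : form J x 0 = 0 := by simp [form]

theorem continuous_form_left (y : K) : Continuous fun x => form J x y := by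
  unfold form; fun_prop

theorem continuous_form_right (x : K) : Continuous fun y => form J x y := by
  unfold form; fun_prop

theorem IsPontryagin.inner_map (hJ : IsPontryagin J) (x y : K) :
    inner ℂ (J x) y = inner ℂ x (J y) := by
  have h := hJ.isSelfAdjoint.adjoint_eq
  rw [← ContinuousLinearMap.adjoint_inner_right, h]

theorem IsPontryagin.map_map (hJ : IsPontryagin J) (x : K) : J (J x) = x := by
  have := congrArg (fun T : K →L[ℂ] K => T x) hJ.sq_eq_one
  simpa using this

theorem IsPontryagin.conj_form (hJ : IsPontryagin J) (x y : K) :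
    conj (form J x y) = form J y x := by
  rw [form, inner_conj_symm, form, hJ.inner_map]

theorem IsPontryagin.form_eq_zero_comm (hJ : IsPontryagin J) {x y : K}
    (h : form J x y = 0) : form J y x = 0 := by
  rw [← hJ.conj_form, h, map_zero]

theorem IsPontryagin.eq_zero_of_form (hJ : IsPontryagin J) {x : K}
    (h : ∀ y, form J y x = 0) : x = 0 := by
  have := h (J x)
  rw [form, hJ.map_map] at this
  exact inner_self_eq_zero.1 this

/-- The negative part of the fundamental decomposition. -/
noncomputable abbrev negPart (J : K →L[ℂ] K) : Submodule ℂ K :=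
  Module.End.eigenspace (J : K →ₗ[ℂ] K) (-1)

theorem mem_negPart {x : K} : x ∈ negPart J ↔ J x = -x := by
  simp [negPart]

/-- With P the projection onto the negative part, (1 - J)(x - Px) lies both in the negative part and
in its orthogonal complement, so it vanishes. Thus J = 1 - 2P is a finite rank perturbation of the
identity. -/
theorem IsPontryagin.map_eq (hJ : IsPontryagin J) (x : K) :
    haveI := hJ.finiteDimensional
    J x = x - (2 : ℂ) • (negPart J).starProjection x := by
  have := hJ.finiteDimensional
  set p := (negPart J).starProjection x with hp
  have hpm : p ∈ negPart J := Submodule.starProjection_apply_mem _ _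
  have hr : x - p ∈ (negPart J)ᗮ := Submodule.sub_starProjection_mem_orthogonal x
  have h1 : (x - p) - J (x - p) ∈ negPart J := by
    rw [mem_negPart, map_sub, hJ.map_map]; abel
  have h2 : (x - p) - J (x - p) ∈ (negPart J)ᗮ := by
    intro v hv
    rw [inner_sub_right, ← hJ.inner_map, mem_negPart.1 hv, inner_neg_left, hr v hv]
    simp
  have h3 : (x - p) - J (x - p) = 0 := inner_self_eq_zero.1 (h2 _ h1)
  rw [map_sub, mem_negPart.1 hpm] at h3
  have h4 : J x = x - p - p := by
    linear_combination (norm := module) (-1 : ℂ) • h3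
  rw [h4, two_smul]; abel

theorem IsPontryagin.re_form_self (hJ : IsPontryagin J) (x : K) :
    haveI := hJ.finiteDimensional
    (form J x x).re = ‖x‖ ^ 2 - 2 * ‖(negPart J).starProjection x‖ ^ 2 := by
  have := hJ.finiteDimensional
  have h : inner ℂ ((negPart J).starProjection x) x
      = ((‖(negPart J).starProjection x‖ ^ 2 : ℝ) : ℂ) := by
    have h1 := Submodule.starProjection_inner_eq_zero (K := negPart J) x _
      (Submodule.starProjection_apply_mem (negPart J) x)
    rw [inner_sub_left, sub_eq_zero] at h1
    rw [← inner_conj_symm, h1, inner_self_eq_norm_sq_to_K]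
    simp
  rw [form, hJ.map_eq, inner_sub_left, inner_smul_left, h, inner_self_eq_norm_sq_to_K]
  simp [← Complex.ofReal_pow]

/-- Subspaces on which the form is neutral embed into the negative part. -/
theorem IsPontryagin.eq_zero_of_neutral (hJ : IsPontryagin J) {x : K}
    (hx : form J x x = 0)
    (h : haveI := hJ.finiteDimensional; (negPart J).starProjection x = 0) : x = 0 := by
  have := hJ.re_form_self x
  rw [hx, h] at this
  simpa using this.symm

theorem IsPontryagin.finiteDimensional_of_neutral (hJ : IsPontryagin J) {N : Submodule ℂ K}
    (hN : ∀ x ∈ N, form J x x = 0) : FiniteDimensional ℂ N := by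
  have := hJ.finiteDimensional
  let f : N →ₗ[ℂ] negPart J := (negPart J).orthogonalProjectionOnto.toLinearMap ∘ₗ N.subtype
  refine Module.Finite.of_injective f ?_
  rw [← LinearMap.ker_eq_bot, LinearMap.ker_eq_bot']
  intro x hx
  have hx' : (negPart J).orthogonalProjectionOnto (x : K) = 0 := hx
  refine Subtype.ext (hJ.eq_zero_of_neutral (hN x x.2) ?_)
  rw [Submodule.starProjection_apply, hx']; rfl

end Form

/-! ### Resolvents of linear relations -/

section Resolvent

variable {J : K →L[ℂ] K} {A : LinRel K}

theorem IsResolventAt.unique {z : ℂ} {B C : K →L[ℂ] K} (hB : IsResolventAt A z B)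
    (hC : IsResolventAt A z C) : B = C := by
  ext u
  exact ((hC u (B u)).1 ((hB u (B u)).2 rfl)).symm

theorem IsResolventAt.res_eq {z : ℂ} {B : K →L[ℂ] K} (hB : IsResolventAt A z B) :
    res A z = B :=
  (res_spec (A := A) (z := z) ⟨B, hB⟩).unique hB

theorem res_mem {z : ℂ} (hz : z ∈ resSet A) (u : K) : (res A z u, u + z • res A z u) ∈ A :=
  (res_spec hz u _).2 rfl

theorem res_sub_smul {z w : ℂ} (hz : z ∈ resSet A) (hw : w ∈ resSet A) (u : K) :
    res A w u = res A z u + (w - z) • res A z (res A w u) := by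
  have h := res_mem hw u
  have h1 : u + w • res A w u = (u + (w - z) • res A w u) + z • res A w u := by module
  rw [h1] at h
  have h2 := (res_spec hz _ _).1 h
  rw [map_add, map_smul] at h2
  exact h2.symm

theorem res_comm {z w : ℂ} (hz : z ∈ resSet A) (hw : w ∈ resSet A) (u : K) :
    res A z (res A w u) = res A w (res A z u) := by
  rcases eq_or_ne z w with rfl | h
  · rfl
  have h1 := res_sub_smul hz hw u
  have h2 := res_sub_smul hw hz u
  have h3 : (w - z) • (res A z (res A w u) - res A w (res A z u)) = 0 := by
    linear_combination (norm := module) - h1 - h2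
  exact sub_eq_zero.1 ((smul_eq_zero.1 h3).resolve_left (sub_ne_zero.2 h.symm))

theorem isResolventAt_of_isUnit {z w : ℂ} (hw : w ∈ resSet A)
    (hu : IsUnit (1 - (z - w) • res A w)) :
    IsResolventAt A z (res A w * Ring.inverse (1 - (z - w) • res A w)) := by
  set R := res A w
  set T := 1 - (z - w) • R with hT
  have hc : Commute R T := by
    rw [hT]; exact (Commute.one_right R).sub_right ((Commute.refl R).smul_right _)
  have hc' : R * Ring.inverse T = Ring.inverse T * R := by
    obtain ⟨t, ht⟩ := hu
    rw [← ht] at hc ⊢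
    rw [Ring.inverse_unit]
    exact hc.units_inv_right
  intro u x
  have h1 : u + z • x = (u + (z - w) • x) + w • x := by module
  rw [h1, res_spec hw, hc', mul_apply_eq_comp]
  have h2 : R (u + (z - w) • x) = x ↔ R u = T x := by
    rw [hT, map_add, map_smul]
    simp only [sub_apply, one_apply_eq_self,
      smul_apply]
    rw [eq_sub_iff_add_eq]
  rw [h2]
  constructor
  · intro h
    rw [h, ← mul_apply_eq_comp, Ring.inverse_mul_cancel _ hu]; rfl
  · intro h
    rw [← h, ← mul_apply_eq_comp, Ring.mul_inverse_cancel _ hu]; rfl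

theorem isResolventAt_conj (hJ : IsPontryagin J) (hA : IsSelfAdjointRel J A) {z : ℂ}
    (hz : z ∈ resSet A) :
    IsResolventAt A (conj z) (J ∘L ContinuousLinearMap.adjoint (res A z) ∘L J) := by
  intro u x
  rw [hA]
  have key : ∀ v, form J (v + z • res A z v) x = form J (res A z v) (u + conj z • x) ↔
      form J v x = form J v ((J ∘L ContinuousLinearMap.adjoint (res A z) ∘L J) u) := by
    intro v
    have h2 : form J v ((J ∘L ContinuousLinearMap.adjoint (res A z) ∘L J) u)
        = form J (res A z v) u := by
      simp only [form, ContinuousLinearMap.comp_apply]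
      rw [hJ.inner_map, hJ.map_map, ContinuousLinearMap.adjoint_inner_right, hJ.inner_map]
    rw [h2, form_add_left, form_add_right, form_smul_left, form_smul_right]
    exact add_left_inj _
  constructor
  · intro h
    symm
    rw [← sub_eq_zero]
    refine hJ.eq_zero_of_form fun v => ?_
    rw [form_sub_right, sub_eq_zero]
    exact (key v).1 (h _ _ (res_mem hz v))
  · intro h a b hab
    have h1 : b = (b - z • a) + z • a := by module
    have h3 : res A z (b - z • a) = a := (res_spec hz _ _).1 (h1 ▸ hab)
    have h4 := (key (b - z • a)).2 (by rw [h])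
    rwa [h3, ← h1] at h4

theorem conj_mem_resSet (hJ : IsPontryagin J) (hA : IsSelfAdjointRel J A) {z : ℂ}
    (hz : z ∈ resSet A) : conj z ∈ resSet A :=
  ⟨_, isResolventAt_conj hJ hA hz⟩

theorem form_res_right (hJ : IsPontryagin J) (hA : IsSelfAdjointRel J A) {z : ℂ}
    (hz : z ∈ resSet A) (x y : K) :
    form J x (res A (conj z) y) = form J (res A z x) y := by
  rw [(isResolventAt_conj hJ hA hz).res_eq]
  simp only [form, ContinuousLinearMap.comp_apply]
  rw [hJ.inner_map, hJ.map_map, ContinuousLinearMap.adjoint_inner_right, hJ.inner_map]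

theorem form_res_left (hJ : IsPontryagin J) (hA : IsSelfAdjointRel J A) {z : ℂ}
    (hz : z ∈ resSet A) (x y : K) :
    form J (res A (conj z) x) y = form J x (res A z y) := by
  have := form_res_right hJ hA (conj_mem_resSet hJ hA hz) x y
  rw [Complex.conj_conj] at this
  exact this.symm

/-- Near v the resolvent is R_v(1 - (w - v)R_v)⁻¹, and inversion is continuous at 1. -/
theorem tendsto_res {v : ℂ} (hv : v ∈ resSet A) :
    (∀ᶠ w in 𝓝 v, w ∈ resSet A) ∧ Filter.Tendsto (res A) (𝓝 v) (𝓝 (res A v)) := by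
  have hcont : ContinuousAt (fun w : ℂ => 1 - (w - v) • res A v) v := by fun_prop
  have h0 : (1 : K →L[ℂ] K) - (v - v) • res A v = ((1 : (K →L[ℂ] K)ˣ) : K →L[ℂ] K) := by simp
  have hev : ∀ᶠ w in 𝓝 v, IsUnit (1 - (w - v) • res A v) := by
    refine hcont.eventually (Units.isOpen.mem_nhds ?_)
    exact ⟨1, h0.symm⟩
  have hres : ∀ᶠ w in 𝓝 v, IsResolventAt A w
      (res A v * Ring.inverse (1 - (w - v) • res A v)) := by
    filter_upwards [hev] with w hw using isResolventAt_of_isUnit hv hw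
  refine ⟨hres.mono fun w hw => ⟨_, hw⟩, ?_⟩
  have hinv : Filter.Tendsto (fun w : ℂ => Ring.inverse (1 - (w - v) • res A v)) (𝓝 v) (𝓝 1) := by
    have h1 := NormedRing.inverse_continuousAt (1 : (K →L[ℂ] K)ˣ)
    have h2 : Filter.Tendsto (fun w : ℂ => 1 - (w - v) • res A v) (𝓝 v)
        (𝓝 ((1 : (K →L[ℂ] K)ˣ) : K →L[ℂ] K)) := by
      have := hcont.tendsto
      rwa [h0] at this
    have := h1.tendsto.comp h2
    simpa [Function.comp_def] using this
  have := hinv.const_mul (res A v)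
  rw [mul_one] at this
  exact this.congr' (hres.mono fun w hw => hw.res_eq.symm)

end Resolvent

/-! ### The defect vectors `(1 + (z - z₀)(A - z)⁻¹) x` -/

section Defect

variable {J : K →L[ℂ] K} {A : LinRel K}

/-- The operator `1 + (z - z₀)(A - z)⁻¹`. -/
noncomputable def defect (A : LinRel K) (z₀ z : ℂ) : K →L[ℂ] K := 1 + (z - z₀) • res A z

theorem defect_apply (z₀ z : ℂ) (x : K) : defect A z₀ z x = x + (z - z₀) • res A z x := rfl

theorem defect_self (z₀ : ℂ) (x : K) : defect A z₀ z₀ x = x := by simp [defect_apply]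

theorem smul_res_defect {z₀ v w : ℂ} (hv : v ∈ resSet A)
    (hw : w ∈ resSet A) (x : K) :
    (w - v) • res A v (defect A z₀ w x) = defect A z₀ w x - defect A z₀ v x := by
  have h1 := res_sub_smul hv hw x
  simp only [defect_apply, map_add, map_smul]
  linear_combination (norm := module) (-(w - z₀)) • h1

/-- The defect operators are adjoint to each other up to the change of base point. -/
theorem form_defect_left (hJ : IsPontryagin J) (hA : IsSelfAdjointRel J A) {z₀ w : ℂ}
    (hw : w ∈ resSet A) (x y : K) :
    form J (defect A z₀ w x) y
      = form J x y + (conj w - conj z₀) * form J x (res A (conj w) y) := by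
  rw [defect_apply, form_add_left, form_smul_left, form_res_right hJ hA hw, map_sub]

end Defect

/-! ### Finite rank perturbations and the nonreal resolvent set -/

section FiniteRank

/-- Injectivity gives surjectivity: 1 + F preserves V and is bijective there, so w + Fw = Fy is
solvable in V, and y - w is a preimage of y. -/
theorem isUnit_one_add_of_finiteRank {F : K →L[ℂ] K} {V : Submodule ℂ K}
    [FiniteDimensional ℂ V] (hF : ∀ x, F x ∈ V) (hinj : ∀ x, x + F x = 0 → x = 0) :
    IsUnit (1 + F) := by
  rw [ContinuousLinearMap.isUnit_iff_bijective]
  have hi : Function.Injective (1 + F : K →L[ℂ] K) := by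
    rw [injective_iff_map_eq_zero]
    intro x hx
    exact hinj x (by simpa using hx)
  refine ⟨hi, fun y => ?_⟩
  let g : V →ₗ[ℂ] V := ((1 + F : K →L[ℂ] K) : K →ₗ[ℂ] K).restrict
    (p := V) (q := V) fun x hx => V.add_mem hx (hF x)
  have hg : Function.Injective g := by
    intro a b hab
    exact Subtype.ext (hi (congrArg Subtype.val hab))
  obtain ⟨w, hw⟩ := (LinearMap.injective_iff_surjective.1 hg) ⟨F y, hF y⟩
  have hw' : (w : K) + F w = F y := congrArg Subtype.val hw
  refine ⟨y - w, ?_⟩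
  change (y - (w : K)) + F (y - w) = y
  rw [map_sub, ← hw']; abel

theorem isUnit_add_of_finiteRank {B F : K →L[ℂ] K} (hB : IsUnit B) {V : Submodule ℂ K}
    [FiniteDimensional ℂ V] (hF : ∀ x, F x ∈ V) (hinj : ∀ x, B x + F x = 0 → x = 0) :
    IsUnit (B + F) := by
  obtain ⟨b, rfl⟩ := hB
  have hb : ∀ x, (b : K →L[ℂ] K) (((b⁻¹ : (K →L[ℂ] K)ˣ) : K →L[ℂ] K) x) = x := fun x => by
    rw [← mul_apply_eq_comp, Units.mul_inv]; rfl
  have h1 : (b : K →L[ℂ] K) + F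
      = (b : K →L[ℂ] K) * (1 + ((b⁻¹ : (K →L[ℂ] K)ˣ) : K →L[ℂ] K) * F) := by
    rw [mul_add, mul_one, Units.mul_inv_cancel_left]
  rw [h1]
  refine b.isUnit.mul (isUnit_one_add_of_finiteRank
    (V := V.map (((b⁻¹ : (K →L[ℂ] K)ˣ) : K →L[ℂ] K) : K →ₗ[ℂ] K)) ?_ ?_)
  · exact fun x => Submodule.mem_map_of_mem (hF x)
  · intro x hx
    refine hinj x ?_
    have h2 := congrArg (b : K →L[ℂ] K) hx
    rwa [map_add, mul_apply_eq_comp, hb, map_zero] at h2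

/-- An operator which is isometric for the form of a Pontryagin space is a finite rank
perturbation of a contraction; hence injectivity of `U - l` with `|l| > 1` is enough for
invertibility. -/
theorem isUnit_sub_smul_of_isometric {J U : K →L[ℂ] K} (hJ : IsPontryagin J)
    (hU : ∀ x, form J (U x) (U x) = form J x x) {l : ℂ} (hl : 1 < ‖l‖)
    (hinj : ∀ x, U x = l • x → x = 0) : IsUnit (U - l • (1 : K →L[ℂ] K)) := by
  have := hJ.finiteDimensional
  let P := (negPart J).orthogonalProjectionOnto
  -- On the kernel N of G both x and Ux have no negative component, so U preserves the Hilbert norm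
  -- there. N has finite codimension because G has finite-dimensional target.
  let G : K →L[ℂ] (negPart J × negPart J) := (P ∘L U).prod P
  let N : Submodule ℂ K := G.ker
  have hNc : IsClosed (N : Set K) := ContinuousLinearMap.isClosed_ker G
  have : CompleteSpace N := hNc.completeSpace_coe
  have hN : ∀ x ∈ N, ‖U x‖ = ‖x‖ := by
    intro x hx
    have hx' : G x = 0 := hx
    have h1 : P (U x) = 0 := congrArg Prod.fst hx'
    have h2 : P x = 0 := congrArg Prod.snd hx'
    have e1 := hJ.re_form_self (U x)
    have e2 := hJ.re_form_self x
    rw [Submodule.starProjection_apply, show (negPart J).orthogonalProjectionOnto (U x) = 0 from h1]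
      at e1
    rw [Submodule.starProjection_apply, show (negPart J).orthogonalProjectionOnto x = 0 from h2]
      at e2
    rw [hU, e2] at e1
    simp only [Submodule.coe_zero, norm_zero] at e1
    have : ‖x‖ ^ 2 = ‖U x‖ ^ 2 := by linarith
    exact ((sq_eq_sq₀ (norm_nonneg _) (norm_nonneg _)).1 this).symm
  have hfin : FiniteDimensional ℂ Nᗮ := by
    refine Module.Finite.of_injective (G.toLinearMap ∘ₗ Nᗮ.subtype) ?_
    rw [← LinearMap.ker_eq_bot, LinearMap.ker_eq_bot']
    intro x hx
    have hxN : (x : K) ∈ N := hx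
    exact Subtype.ext (inner_self_eq_zero.1 (x.2 _ hxN))
  let W : K →L[ℂ] K := U ∘L N.starProjection
  have hW : ‖W‖ ≤ 1 := by
    refine ContinuousLinearMap.opNorm_le_bound _ zero_le_one fun x => ?_
    rw [one_mul]
    change ‖U (N.starProjection x)‖ ≤ ‖x‖
    rw [hN _ (Submodule.starProjection_apply_mem _ _)]
    exact Submodule.norm_starProjection_apply_le N x
  have hWl : IsUnit (W - l • (1 : K →L[ℂ] K)) := by
    have h1 : l ∈ resolventSet ℂ W := by
      refine spectrum.mem_resolventSet_of_norm_lt_mul (lt_of_le_of_lt ?_ hl)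
      exact mul_le_one₀ hW (norm_nonneg _) ContinuousLinearMap.norm_id_le
    rw [spectrum.mem_resolventSet_iff, Algebra.algebraMap_eq_smul_one] at h1
    rw [← neg_sub]
    exact h1.neg
  have h2 : U - l • (1 : K →L[ℂ] K) = (W - l • 1) + U ∘L Nᗮ.starProjection := by
    ext x
    have := N.starProjection_add_starProjection_orthogonal x
    simp only [W, sub_apply, add_apply, ContinuousLinearMap.comp_apply]
    nth_rw 1 [← this]
    rw [map_add]; abel
  rw [h2]
  refine isUnit_add_of_finiteRank hWl (V := Nᗮ.map (U : K →ₗ[ℂ] K)) ?_ ?_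
  · exact fun x => Submodule.mem_map_of_mem (Submodule.starProjection_apply_mem _ _)
  · intro x hx
    refine hinj x (sub_eq_zero.1 ?_)
    have h3 := congrArg (fun T : K →L[ℂ] K => T x) h2
    exact h3.trans hx

end FiniteRank

section Spectrum

variable {J : K →L[ℂ] K} {A : LinRel K}

/-- The eigenvalues of a self-adjoint relation in the upper half-plane are finite in number. -/
theorem finite_eigenvalues_upper (hJ : IsPontryagin J) (hA : IsSelfAdjointRel J A) {z₀ : ℂ}
    (h₀ : z₀ ∈ resSet A) : {z : ℂ | 0 < z.im ∧ ∃ f : K, f ≠ 0 ∧ (f, z • f) ∈ A}.Finite := by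
  have := hJ.finiteDimensional
  set E := {z : ℂ | 0 < z.im ∧ ∃ f : K, f ≠ 0 ∧ (f, z • f) ∈ A}
  have hE : ∀ z : E, ∃ f : K, f ≠ 0 ∧ (f, (z : ℂ) • f) ∈ A := fun z => z.2.2
  choose f hf0 hfA using hE
  have hres : ∀ z : E, f z = ((z : ℂ) - z₀) • res A z₀ (f z) := by
    intro z
    have h1 : (z : ℂ) • f z = ((z : ℂ) - z₀) • f z + z₀ • f z := by module
    have h2 := hfA z
    rw [h1] at h2
    have h3 := (res_spec h₀ _ _).1 h2
    rw [map_smul] at h3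
    exact h3.symm
  have hne : ∀ z : E, (z : ℂ) - z₀ ≠ 0 := by
    intro z h
    have := hres z
    rw [h, zero_smul] at this
    exact hf0 z this
  have hli : LinearIndependent ℂ f := by
    refine Module.End.eigenvectors_linearIndependent' (res A z₀ : K →ₗ[ℂ] K)
      (fun z : E => ((z : ℂ) - z₀)⁻¹) ?_ f fun z => ⟨?_, hf0 z⟩
    · intro z w hzw
      exact Subtype.ext (sub_left_injective (inv_injective hzw))
    · rw [Module.End.mem_eigenspace_iff]
      change res A z₀ (f z) = _
      rw [eq_comm, inv_smul_eq_iff₀ (hne z)]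
      exact hres z
  -- Self-adjointness gives (conj z - w)[f_z, f_w] = 0, and conj z ≠ w when both lie in the upper
  -- half-plane. So the eigenvectors, also those with z = w, span a neutral subspace.
  have horth : ∀ z w : E, form J (f z) (f w) = 0 := by
    intro z w
    have h1 := ((hA _ _).1 (hfA w)) _ _ (hfA z)
    rw [form_smul_left, form_smul_right] at h1
    have h2 : (conj (z : ℂ) - w) * form J (f z) (f w) = 0 := by linear_combination h1
    refine (mul_eq_zero.1 h2).resolve_left fun h => ?_
    have h3 := congrArg Complex.im h
    simp only [Complex.sub_im, Complex.conj_im, Complex.zero_im] at h3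
    have := z.2.1
    have := w.2.1
    linarith
  have hneut : ∀ x ∈ Submodule.span ℂ (Set.range f), form J x x = 0 := by
    have h1 : ∀ z : E, ∀ x ∈ Submodule.span ℂ (Set.range f), form J (f z) x = 0 := by
      intro z x hx
      induction hx using Submodule.span_induction with
      | mem x h => obtain ⟨w, rfl⟩ := h; exact horth z w
      | zero => simp
      | add x y _ _ hx hy => rw [form_add_right, hx, hy, add_zero]
      | smul c x _ hx => rw [form_smul_right, hx, mul_zero]
    intro x hx
    have h2 : ∀ y ∈ Submodule.span ℂ (Set.range f), form J y x = 0 := by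
      intro y hy
      induction hy using Submodule.span_induction with
      | mem y h => obtain ⟨w, rfl⟩ := h; exact h1 w x hx
      | zero => simp
      | add y z _ _ hy hz => rw [form_add_left, hy, hz, add_zero]
      | smul c y _ hy => rw [form_smul_left, hy, mul_zero]
    exact h2 x hx
  have := hJ.finiteDimensional_of_neutral hneut
  have hli' : LinearIndependent ℂ
      (fun z : E => (⟨f z, Submodule.subset_span ⟨z, rfl⟩⟩ : Submodule.span ℂ (Set.range f))) :=
    LinearIndependent.of_comp (Submodule.subtype _) hli
  have : Finite E := hli'.finite
  exact Set.toFinite E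

/-- Points of the upper half-plane which are not eigenvalues belong to the resolvent set. -/
theorem mem_resSet_of_not_eigenvalue (hJ : IsPontryagin J) (hA : IsSelfAdjointRel J A) {z₀ z : ℂ}
    (h₀ : z₀ ∈ resSet A) (hz₀ : 0 < z₀.im) (hz : 0 < z.im)
    (hinj : ∀ f : K, (f, z • f) ∈ A → f = 0) : z ∈ resSet A := by
  rcases eq_or_ne z z₀ with rfl | hne
  · exact h₀
  have hne' : z - z₀ ≠ 0 := sub_ne_zero.2 hne
  set R := res A z₀ with hR
  set c : ℂ := z₀ - conj z₀ with hc
  have hc0 : c ≠ 0 := by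
    intro h
    have := congrArg Complex.im h
    simp [hc] at this
    linarith
  have hcc : conj c = -c := by simp [hc]
  -- The Cayley transform U = 1 + (z₀ - conj z₀)R is isometric for the form. It turns the point z
  -- into l, and |l| > 1 since z and z₀ lie in the same half-plane.
  set l : ℂ := (z - conj z₀) / (z - z₀) with hl
  have hl1 : 1 < ‖l‖ := by
    rw [hl, norm_div, one_lt_div (norm_pos_iff.2 hne')]
    refine lt_of_pow_lt_pow_left₀ 2 (norm_nonneg _) ?_
    rw [← Complex.normSq_eq_norm_sq, ← Complex.normSq_eq_norm_sq, Complex.normSq_apply,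
      Complex.normSq_apply]
    simp only [Complex.sub_re, Complex.sub_im, Complex.conj_re, Complex.conj_im]
    nlinarith [mul_pos hz hz₀]
  have hiso : ∀ x, form J ((1 + c • R) x) ((1 + c • R) x) = form J x x := by
    intro x
    have h1 : res A (conj z₀) x = R x + (conj z₀ - z₀) • res A (conj z₀) (R x) := by
      rw [res_sub_smul h₀ (conj_mem_resSet hJ hA h₀) x, res_comm h₀ (conj_mem_resSet hJ hA h₀)]
    have h2 := form_res_right hJ hA h₀ x x
    have h3 := form_res_right hJ hA h₀ x (R x)
    rw [h1, form_add_right, form_smul_right, h3] at h2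
    have h4 : conj z₀ - z₀ = -c := by rw [hc]; ring
    rw [h4] at h2
    change form J (x + c • R x) (x + c • R x) = _
    rw [form_add_left, form_add_right, form_add_right, form_smul_left, form_smul_left,
      form_smul_right, form_smul_right, hcc]
    linear_combination c * h2
  have hT : (1 : K →L[ℂ] K) - (z - z₀) • R
      = (-((z - z₀) / c)) • ((1 + c • R) - l • (1 : K →L[ℂ] K)) := by
    have e1 : -((z - z₀) / c) * (1 - l) = 1 := by
      rw [hl]; field_simp; rw [hc]; ring
    have e2 : -((z - z₀) / c) * c = -(z - z₀) := by field_simp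
    have : (1 + c • R) - l • (1 : K →L[ℂ] K) = (1 - l) • 1 + c • R := by module
    rw [this, smul_add, smul_smul, smul_smul, e1, e2]
    module
  have hu : IsUnit (1 - (z - z₀) • R) := by
    have h1 : IsUnit ((1 + c • R) - l • (1 : K →L[ℂ] K)) := by
      refine isUnit_sub_smul_of_isometric hJ hiso hl1 fun x hx => ?_
      have h2 : ((1 : K →L[ℂ] K) - (z - z₀) • R) x = 0 := by
        rw [hT]
        simp only [smul_apply, sub_apply, one_apply_eq_self, hx, sub_self, smul_zero]
      have h3 : x = (z - z₀) • R x := by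
        simpa [sub_eq_zero] using h2
      have h4 := res_mem h₀ x
      rw [← hR] at h4
      have h5 : x + z₀ • R x = z • R x := by
        nth_rw 1 [h3]; module
      rw [h5] at h4
      rw [h3, hinj _ h4, smul_zero]
    rw [hT]
    have hd : -((z - z₀) / c) ≠ 0 := neg_ne_zero.2 (div_ne_zero hne' hc0)
    exact h1.smul (Units.mk0 _ hd)
  exact ⟨_, isResolventAt_of_isUnit h₀ hu⟩

theorem finite_upper_diff_resSet (hJ : IsPontryagin J) (hA : IsSelfAdjointRel J A) {z₀ : ℂ}
    (h₀ : z₀ ∈ resSet A) (hz₀ : 0 < z₀.im) : {z : ℂ | 0 < z.im ∧ z ∉ resSet A}.Finite := by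
  refine (finite_eigenvalues_upper hJ hA h₀).subset ?_
  rintro z ⟨hz, hzr⟩
  refine ⟨hz, ?_⟩
  by_contra! h
  exact hzr (mem_resSet_of_not_eigenvalue hJ hA h₀ hz₀ hz fun f hf => by_contra fun h' => h f h' hf)

end Spectrum

open Filter

/-! ### Weak limits modulo the isotropic part -/

section WeakLimit

/-- A bounded sequence which converges weakly against a total set has a weak limit. -/
theorem exists_weak_limit {p : ℕ → K} {C : ℝ} (hC : ∀ n, ‖p n‖ ≤ C)
    (hd : ∀ v : K, (∀ u : K, (∃ l, Tendsto (fun n => inner ℂ u (p n)) atTop (𝓝 l)) →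
      inner ℂ u v = 0) → v = 0) :
    ∃ q : K, ∀ u : K, Tendsto (fun n => inner ℂ u (p n)) atTop (𝓝 (inner ℂ u q)) := by
  let W : Submodule ℂ K :=
    { carrier := {u | ∃ l, Tendsto (fun n => inner ℂ u (p n)) atTop (𝓝 l)}
      add_mem' := by
        rintro a b ⟨l, hl⟩ ⟨m, hm⟩
        exact ⟨l + m, by simpa only [inner_add_left] using hl.add hm⟩
      zero_mem' := ⟨0, by simp⟩
      smul_mem' := by
        rintro c a ⟨l, hl⟩
        exact ⟨conj c * l, by simpa only [inner_smul_left] using hl.const_mul (conj c)⟩ }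
  have hW : W.topologicalClosure = ⊤ := by
    rw [Submodule.topologicalClosure_eq_top_iff, Submodule.eq_bot_iff]
    intro v hv
    exact hd v fun u hu => hv u hu
  have hC0 : 0 ≤ C := (norm_nonneg _).trans (hC 0)
  have hall : ∀ u : K, ∃ l, Tendsto (fun n => inner ℂ u (p n)) atTop (𝓝 l) := by
    intro u
    apply cauchySeq_tendsto_of_complete
    rw [Metric.cauchySeq_iff']
    intro ε hε
    have hu : u ∈ closure (W : Set K) := by
      rw [← Submodule.topologicalClosure_coe, hW]; trivial
    -- C + 1 replaces C because C may be zero.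
    obtain ⟨w, ⟨l, hl⟩, hw⟩ := Metric.mem_closure_iff.1 hu (ε / (4 * (C + 1))) (by positivity)
    obtain ⟨N, hN⟩ := Metric.cauchySeq_iff'.1 hl.cauchySeq (ε / 2) (by positivity)
    refine ⟨N, fun n hn => ?_⟩
    have h1 : ∀ m, ‖inner ℂ (u - w) (p m)‖ ≤ ε / 4 := by
      intro m
      refine (norm_inner_le_norm _ _).trans ?_
      rw [← dist_eq_norm]
      calc dist u w * ‖p m‖ ≤ (ε / (4 * (C + 1))) * (C + 1) := by
            gcongr
            linarith [hC m]
        _ = ε / 4 := by field_simp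
    have h2 := hN n hn
    rw [dist_eq_norm] at h2 ⊢
    have h3 : inner ℂ u (p n) - inner ℂ u (p N)
        = (inner ℂ w (p n) - inner ℂ w (p N)) + inner ℂ (u - w) (p n)
          - inner ℂ (u - w) (p N) := by
      rw [inner_sub_left, inner_sub_left]; ring
    rw [h3]
    have h4 := norm_sub_le ((inner ℂ w (p n) - inner ℂ w (p N)) + inner ℂ (u - w) (p n))
      (inner ℂ (u - w) (p N))
    have h5 := norm_add_le (inner ℂ w (p n) - inner ℂ w (p N)) (inner ℂ (u - w) (p n))
    linarith [h1 n, h1 N]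
  choose l hl using hall
  have hconj : ∀ u, Tendsto (fun n => inner ℂ (p n) u) atTop (𝓝 (conj (l u))) := by
    intro u
    simpa only [inner_conj_symm, Function.comp_def] using
      (Complex.continuous_conj.tendsto _).comp (hl u)
  let φ : K →ₗ[ℂ] ℂ :=
    { toFun := fun u => conj (l u)
      map_add' := fun a b => by
        refine tendsto_nhds_unique (hconj (a + b)) ?_
        simpa only [inner_add_right] using (hconj a).add (hconj b)
      map_smul' := fun c a => by
        refine tendsto_nhds_unique (hconj (c • a)) ?_
        simpa only [inner_smul_right, smul_eq_mul] using! (hconj a).const_mul c }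
  have hφ : ∀ u, ‖φ u‖ ≤ C * ‖u‖ := by
    intro u
    refine le_of_tendsto (hconj u).norm (Eventually.of_forall fun n => ?_)
    exact (norm_inner_le_norm _ _).trans (by gcongr; exact hC n)
  let ψ : StrongDual ℂ K := φ.mkContinuous C hφ
  refine ⟨(InnerProductSpace.toDual ℂ K).symm ψ, fun u => ?_⟩
  have h1 : inner ℂ ((InnerProductSpace.toDual ℂ K).symm ψ) u = conj (l u) :=
    InnerProductSpace.toDual_symm_apply
  rw [← inner_conj_symm, h1, Complex.conj_conj]
  exact hl u

/-- The isotropic part of a subspace. -/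
noncomputable def isotropicPart (J : K →L[ℂ] K) (M : Submodule ℂ K) : Submodule ℂ K :=
  { carrier := {x | x ∈ M ∧ ∀ y ∈ M, form J y x = 0}
    add_mem' := by
      rintro a b ⟨ha, ha'⟩ ⟨hb, hb'⟩
      exact ⟨M.add_mem ha hb, fun y hy => by rw [form_add_right, ha' y hy, hb' y hy, add_zero]⟩
    zero_mem' := ⟨M.zero_mem, fun y _ => form_zero_right y⟩
    smul_mem' := by
      rintro c a ⟨ha, ha'⟩
      exact ⟨M.smul_mem c ha, fun y hy => by rw [form_smul_right, ha' y hy, mul_zero]⟩ }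

variable {J : K →L[ℂ] K} {M : Submodule ℂ K}

theorem mem_isotropicPart {x : K} :
    x ∈ isotropicPart J M ↔ x ∈ M ∧ ∀ y ∈ M, form J y x = 0 := Iff.rfl

theorem isClosed_isotropicPart (hM : IsClosed (M : Set K)) :
    IsClosed (isotropicPart J M : Set K) := by
  have : (isotropicPart J M : Set K) = (M : Set K) ∩ ⋂ y ∈ M, {x | form J y x = 0} := by
    ext x; simp [mem_isotropicPart]
  rw [this]
  refine hM.inter (isClosed_biInter fun y _ => ?_)
  exact isClosed_eq (continuous_form_right y) continuous_const

theorem isotropicPart_top (hJ : IsPontryagin J) : isotropicPart J (⊤ : Submodule ℂ K) = ⊥ := by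
  rw [Submodule.eq_bot_iff]
  exact fun x hx => hJ.eq_zero_of_form fun y => hx.2 y trivial

theorem IsPontryagin.finiteDimensional_isotropicPart (hJ : IsPontryagin J) :
    FiniteDimensional ℂ (isotropicPart J M) :=
  hJ.finiteDimensional_of_neutral fun x hx => hx.2 x hx.1

/-- Orthogonality to a set with dense span. -/
theorem form_eq_zero_of_dense {E : Set K} (hE : (Submodule.span ℂ E).topologicalClosure = M)
    {x : K} (h : ∀ e ∈ E, form J e x = 0) : ∀ y ∈ M, form J y x = 0 := by
  intro y hy
  rw [← hE] at hy
  have hcl : IsClosed {y | form J y x = 0} :=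
    isClosed_eq (continuous_form_left x) continuous_const
  refine closure_minimal (fun y hy => ?_) hcl hy
  induction hy using Submodule.span_induction with
  | mem y h' => exact h y h'
  | zero => simp
  | add a b _ _ ha hb =>
    simp only [Set.mem_ofPred_eq] at ha hb ⊢
    rw [form_add_left, ha, hb, add_zero]
  | smul c a _ ha =>
    simp only [Set.mem_ofPred_eq] at ha ⊢
    rw [form_smul_left, ha, mul_zero]

/-- The inner products with p_n converge for the vectors J e, and vanish for the vectors of Mᗮ and
of the isotropic part. A vector orthogonal to all of these lies in M, is isotropic, and is
orthogonal to the isotropic part, so it is zero. This is the totality that `exists_weak_limit`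
needs. -/
theorem exists_weak_limit_of_form_tendsto (hM : IsClosed (M : Set K))
    {E : Set K} (hE : (Submodule.span ℂ E).topologicalClosure = M) {p : ℕ → K} {C : ℝ}
    (hC : ∀ n, ‖p n‖ ≤ C) (hpM : ∀ n, p n ∈ M) (hpO : ∀ n, p n ∈ (isotropicPart J M)ᗮ)
    (hlim : ∀ e ∈ E, ∃ l, Tendsto (fun n => form J e (p n)) atTop (𝓝 l)) :
    ∃ q ∈ M, q ∈ (isotropicPart J M)ᗮ ∧
      ∀ u : K, Tendsto (fun n => inner ℂ u (p n)) atTop (𝓝 (inner ℂ u q)) := by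
  have : CompleteSpace M := hM.completeSpace_coe
  have hMM : Mᗮᗮ = M := Submodule.orthogonal_orthogonal M
  have hperp : ∀ u ∈ Mᗮ, ∀ n, inner ℂ u (p n) = 0 := fun u hu n => by
    rw [← inner_conj_symm, hu _ (hpM n), map_zero]
  obtain ⟨q, hq⟩ := exists_weak_limit hC fun v hv => by
    have hvM : v ∈ M := by
      rw [← hMM]
      exact fun u hu => hv u ⟨0, by simp [hperp u hu]⟩
    have hvO : v ∈ isotropicPart J M := by
      refine ⟨hvM, form_eq_zero_of_dense hE fun e he => ?_⟩
      exact hv (J e) (hlim e he)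
    exact inner_self_eq_zero.1 (hv v ⟨0, by simp [hpO _ v hvO]⟩)
  refine ⟨q, ?_, ?_, hq⟩
  · rw [← hMM]
    intro u hu
    refine tendsto_nhds_unique (hq u) ?_
    simp [hperp u hu]
  · intro u hu
    refine tendsto_nhds_unique (hq u) ?_
    simp [hpO _ u hu]

theorem tendsto_negPart_projection (hJ : IsPontryagin J) {p : ℕ → K}
    (h : ∀ u : K, Tendsto (fun n => inner ℂ u (p n)) atTop (𝓝 0)) :
    haveI := hJ.finiteDimensional
    Tendsto (fun n => (negPart J).starProjection (p n)) atTop (𝓝 0) := by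
  have := hJ.finiteDimensional
  have h1 : ∀ n, (negPart J).starProjection (p n)
      = ∑ i, inner ℂ ((stdOrthonormalBasis ℂ (negPart J) i : negPart J) : K) (p n) •
        ((stdOrthonormalBasis ℂ (negPart J) i : negPart J) : K) := by
    intro n
    have := congrArg Subtype.val ((stdOrthonormalBasis ℂ (negPart J)).sum_repr'
      ((negPart J).orthogonalProjectionOnto (p n)))
    simpa using this.symm
  simp_rw [h1]
  rw [← Finset.sum_const_zero (ι := Fin (Module.finrank ℂ (negPart J))) (s := Finset.univ)]
  refine tendsto_finsetSum _ fun i _ => ?_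
  simpa using (h ((stdOrthonormalBasis ℂ (negPart J) i : negPart J) : K)).smul_const
    ((stdOrthonormalBasis ℂ (negPart J) i : negPart J) : K)

/-- In a Pontryagin space, boundedness of `[x, x]` and convergence of `[e, x]` for a total set of
vectors `e` imply weak convergence with respect to the form. -/
theorem exists_form_limit (hJ : IsPontryagin J) (hM : IsClosed (M : Set K))
    {E : Set K} (hE : (Submodule.span ℂ E).topologicalClosure = M) {x : ℕ → K}
    (hxM : ∀ n, x n ∈ M) {B : ℝ} (hB : ∀ n, (form J (x n) (x n)).re ≤ B)
    (hlim : ∀ e ∈ E, ∃ l, Tendsto (fun n => form J e (x n)) atTop (𝓝 l)) :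
    ∃ q ∈ M, ∀ y ∈ M, Tendsto (fun n => form J y (x n)) atTop (𝓝 (form J y q)) := by
  have := hJ.finiteDimensional
  set O := isotropicPart J M with hO
  have hOc : IsClosed (O : Set K) := isClosed_isotropicPart hM
  have : CompleteSpace O := hOc.completeSpace_coe
  have hOM : ∀ {v}, v ∈ O → v ∈ M := fun hv => hv.1
  have hEM : ∀ e ∈ E, e ∈ M := fun e he => by
    rw [← hE]; exact Submodule.le_topologicalClosure _ (Submodule.subset_span he)
  set p : ℕ → K := fun n => x n - O.starProjection (x n) with hp
  have hproj : ∀ n, O.starProjection (x n) ∈ O := fun n => Submodule.starProjection_apply_mem _ _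
  have hpM : ∀ n, p n ∈ M := fun n => M.sub_mem (hxM n) (hOM (hproj n))
  have hpO : ∀ n, p n ∈ Oᗮ := fun n => Submodule.sub_starProjection_mem_orthogonal _
  have hform : ∀ y ∈ M, ∀ n, form J y (p n) = form J y (x n) := fun y hy n => by
    rw [hp, form_sub_right, (hproj n).2 y hy, sub_zero]
  have hformp : ∀ n, form J (p n) (p n) = form J (x n) (x n) := fun n => by
    rw [hform _ (hpM n), ← hJ.conj_form, hform _ (hxM n), hJ.conj_form]
  have hlim' : ∀ e ∈ E, ∃ l, Tendsto (fun n => form J e (p n)) atTop (𝓝 l) := by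
    intro e he
    simpa only [hform e (hEM e he)] using hlim e he
  -- If p were unbounded, normalized terms y_k would converge weakly to a vector that is isotropic
  -- and orthogonal to the isotropic part, hence to 0. Their finite-dimensional negative components
  -- then tend to 0 in norm while [y_k, y_k] has upper limit at most 0, which contradicts ‖y_k‖ = 1.
  -- The indices m k need not increase, since only boundedness of [e, p n] is used.
  have hbdd : ∃ C, ∀ n, ‖p n‖ ≤ C := by
    by_contra! hcon
    choose m hm using fun k : ℕ => hcon ((k : ℝ) + 1)
    have hpos : ∀ k, 0 < ‖p (m k)‖ := fun k => lt_trans (by positivity) (hm k)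
    set c : ℕ → ℝ := fun k => ‖p (m k)‖⁻¹ with hc
    have hc0 : Tendsto c atTop (𝓝 0) := by
      refine squeeze_zero (fun k => by positivity) (fun k => ?_)
        (tendsto_one_div_add_atTop_nhds_zero_nat (𝕜 := ℝ))
      rw [hc, one_div]
      exact inv_anti₀ (by positivity) (hm k).le
    set y : ℕ → K := fun k => (c k : ℂ) • p (m k) with hy
    have hynorm : ∀ k, ‖y k‖ = 1 := fun k => by
      rw [hy, norm_smul, Complex.norm_real, hc]
      simp [(hpos k).ne']
    have hye : ∀ e ∈ E, Tendsto (fun k => form J e (y k)) atTop (𝓝 0) := by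
      intro e he
      obtain ⟨l, hl⟩ := hlim' e he
      obtain ⟨D, hD⟩ := (Metric.isBounded_range_of_tendsto _ hl).exists_norm_le
      have hD' : ∀ k, ‖form J e (p (m k))‖ ≤ D := fun k => hD _ ⟨m k, rfl⟩
      refine squeeze_zero_norm (a := fun k => c k * D) (fun k => ?_) (by simpa using hc0.mul_const D)
      rw [hy, form_smul_right, norm_mul, Complex.norm_real, Real.norm_of_nonneg (by positivity)]
      exact mul_le_mul_of_nonneg_left (hD' k) (by positivity)
    obtain ⟨q, hqM, hqO, hq⟩ := exists_weak_limit_of_form_tendsto hM hE (p := y) (C := 1)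
      (fun k => (hynorm k).le) (fun k => M.smul_mem _ (hpM _)) (fun k => Oᗮ.smul_mem _ (hpO _))
      (fun e he => ⟨0, hye e he⟩)
    have hqO' : q ∈ O := ⟨hqM, form_eq_zero_of_dense hE fun e he =>
      tendsto_nhds_unique (hq (J e)) (hye e he)⟩
    have hq0 : q = 0 := inner_self_eq_zero.1 (hqO q hqO')
    rw [hq0] at hq
    have hneg := (tendsto_negPart_projection hJ (p := y) (by simpa using hq)).norm
    have h1 : ∀ k, (form J (y k) (y k)).re ≤ c k ^ 2 * |B| := by
      intro k
      rw [hy, form_smul_left, form_smul_right, hformp, Complex.conj_ofReal, ← mul_assoc,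
        ← Complex.ofReal_mul, Complex.re_ofReal_mul, ← sq]
      exact mul_le_mul_of_nonneg_left ((hB _).trans (le_abs_self _)) (sq_nonneg _)
    have h2 : ∀ k, (1 : ℝ) ≤ c k ^ 2 * |B| + 2 * ‖(negPart J).starProjection (y k)‖ ^ 2 := by
      intro k
      have e1 := hJ.re_form_self (y k)
      rw [hynorm] at e1
      linarith [h1 k]
    have h3 : Tendsto (fun k => c k ^ 2 * |B| + 2 * ‖(negPart J).starProjection (y k)‖ ^ 2) atTop
        (𝓝 (0 ^ 2 * |B| + 2 * ‖(0 : K)‖ ^ 2)) :=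
      ((hc0.pow 2).mul_const _).add ((hneg.pow 2).const_mul 2)
    have h4 := ge_of_tendsto' h3 h2
    norm_num at h4
  obtain ⟨C, hC⟩ := hbdd
  obtain ⟨q, hqM, -, hq⟩ := exists_weak_limit_of_form_tendsto hM hE hC hpM hpO hlim'
  refine ⟨q, hqM, fun y hy => ?_⟩
  simp only [← hform y hy]
  exact hq (J y)

end WeakLimit

/-! ### Asymptotics at infinity -/

theorem ringInverse_smul {R : Type*} [Ring R] [Algebra ℂ R] {c : ℂ} (hc : c ≠ 0) {a : R}
    (ha : IsUnit a) : Ring.inverse (c • a) = c⁻¹ • Ring.inverse a := by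
  obtain ⟨u, rfl⟩ := ha
  have h : c • (u : R) = ((⟨c • (u : R), c⁻¹ • ((u⁻¹ : Rˣ) : R), by
    simp [hc], by simp [hc]⟩ : Rˣ) : R) := rfl
  rw [h, Ring.inverse_unit, Ring.inverse_unit]
  rfl

theorem isUnit_smul {R : Type*} [Ring R] [Algebra ℂ R] {c : ℂ} (hc : c ≠ 0) {a : R}
    (ha : IsUnit a) : IsUnit (c • a) := ha.smul (Units.mk0 c hc)

/-- If `Q(z) = Γ⁺(A - z)⁻¹Γ` with bounded `A` and `Γ⁺Γ` is invertible, then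
`-Q(z)⁻¹ ∼ z (Γ⁺Γ)⁻¹` at infinity. -/
theorem negInv_asymptotics {D : Set ℂ} {Q : ℂ → H →L[ℂ] H} {A : K →L[ℂ] K} {C : K →L[ℂ] H}
    {Γ : H →L[ℂ] K}
    (hrep : ∀ z ∈ D, IsUnit (A - z • (1 : K →L[ℂ] K)) →
      Q z = C.comp ((Ring.inverse (A - z • (1 : K →L[ℂ] K))).comp Γ))
    (hS : IsUnit (C.comp Γ)) :
    ∃ G : ℂ → H →L[ℂ] H,
      Tendsto G (Bornology.cobounded ℂ) (𝓝 (Ring.inverse (C.comp Γ))) ∧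
      ∀ᶠ z in Bornology.cobounded ℂ, z ∈ D → IsUnit (Q z) ∧ negInv Q z = z • G z := by
  -- With t = 1/z the point at infinity moves to 0, where F is continuous with invertible value, and
  -- Q(z) = -z⁻¹F(1/z).
  set F : ℂ → H →L[ℂ] H := fun t => C.comp ((Ring.inverse (1 - t • A)).comp Γ) with hF
  have hcont : ContinuousAt (fun t : ℂ => 1 - t • A) 0 := by fun_prop
  have h0 : (1 : K →L[ℂ] K) - (0 : ℂ) • A = ((1 : (K →L[ℂ] K)ˣ) : K →L[ℂ] K) := by simp
  have hF0 : F 0 = C.comp Γ := by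
    rw [hF]; simp only [zero_smul, sub_zero, Ring.inverse_one]; rfl
  have hinv : ContinuousAt (fun t : ℂ => Ring.inverse (1 - t • A)) 0 := by
    refine ContinuousAt.comp (g := Ring.inverse) ?_ hcont
    rw [h0]
    exact NormedRing.inverse_continuousAt _
  have hFc : ContinuousAt F 0 :=
    continuousAt_const.clm_comp (hinv.clm_comp continuousAt_const)
  have hFu : ∀ᶠ t in 𝓝 (0 : ℂ), IsUnit (F t) := by
    refine hFc.eventually (Units.isOpen.mem_nhds ?_)
    rw [hF0]; exact hS
  have hAu : ∀ᶠ t in 𝓝 (0 : ℂ), IsUnit (1 - t • A) := by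
    refine hcont.eventually (Units.isOpen.mem_nhds ?_)
    exact ⟨1, h0.symm⟩
  have hGc : ContinuousAt (fun t => Ring.inverse (F t)) 0 := by
    refine ContinuousAt.comp (g := Ring.inverse) ?_ hFc
    rw [hF0]
    obtain ⟨s, hs⟩ := hS
    rw [← hs]
    exact NormedRing.inverse_continuousAt _
  have hinf : Tendsto (fun z : ℂ => z⁻¹) (Bornology.cobounded ℂ) (𝓝 0) :=
    tendsto_inv₀_cobounded
  refine ⟨fun z => Ring.inverse (F z⁻¹), ?_, ?_⟩
  · have := hGc.tendsto.comp hinf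
    rwa [hF0] at this
  · filter_upwards [hinf.eventually hFu, hinf.eventually hAu,
      Bornology.eventually_ne_cobounded (0 : ℂ)] with z h1 h2 h3 hz
    have e1 : A - z • (1 : K →L[ℂ] K) = (-z) • (1 - z⁻¹ • A) := by
      rw [smul_sub, smul_smul, neg_mul, mul_inv_cancel₀ h3]; module
    have h3' : -z ≠ 0 := neg_ne_zero.2 h3
    have e2 : Q z = (-z)⁻¹ • F z⁻¹ := by
      rw [hrep z hz (by rw [e1]; exact isUnit_smul h3' h2), e1, ringInverse_smul h3' h2, hF]
      simp only [ContinuousLinearMap.smul_comp, ContinuousLinearMap.comp_smul]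
    refine ⟨by rw [e2]; exact isUnit_smul (inv_ne_zero h3') h1, ?_⟩
    rw [negInv, e2, ringInverse_smul (inv_ne_zero h3') h1, inv_inv, neg_smul, neg_neg]

section Representation

variable {D : Set ℂ} {Q : ℂ → H →L[ℂ] H} {J : K →L[ℂ] K} {A : LinRel K} {Γ : H →L[ℂ] K} {z₀ : ℂ}

theorem IsRepresentation.inner_apply (h : IsRepresentation D Q J A Γ z₀) {z : ℂ} (hz : z ∈ D)
    (hzr : z ∈ resSet A) (x y : H) :
    inner ℂ x (Q z y) = inner ℂ x (ContinuousLinearMap.adjoint (Q z₀) y)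
      + (z - conj z₀) * form J (Γ x) (defect A z₀ z (Γ y)) := by
  rw [h.eq z hz hzr, ← inner_plusAdjoint, ← inner_smul_right, ← inner_add_right]
  rfl

theorem IsRepresentation.tendsto_form (h : IsRepresentation D Q J A Γ z₀) {G : ℂ → H →L[ℂ] H}
    {T : H →L[ℂ] H} (hG : Tendsto G (Bornology.cobounded ℂ) (𝓝 T))
    {z : ℕ → ℂ} (hz : Tendsto z atTop (Bornology.cobounded ℂ))
    (hzD : ∀ᶠ n in atTop, z n ∈ D ∧ Q (z n) = z n • G (z n)) (hzr : ∀ n, z n ∈ resSet A)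
    (x y : H) :
    Tendsto (fun n => form J (Γ x) (defect A z₀ (z n) (Γ y))) atTop (𝓝 (inner ℂ x (T y))) := by
  have hinf : Tendsto (fun n => (z n)⁻¹) atTop (𝓝 0) := tendsto_inv₀_cobounded.comp hz
  have hGz : Tendsto (fun n => inner ℂ x (G (z n) y)) atTop (𝓝 (inner ℂ x (T y))) := by
    have hc : Continuous fun B : H →L[ℂ] H => inner ℂ x (B y) := by fun_prop
    exact (hc.tendsto T).comp (hG.comp hz)
  have h1 : Tendsto (fun n => 1 - conj z₀ * (z n)⁻¹) atTop (𝓝 1) := by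
    simpa using (hinf.const_mul (conj z₀)).const_sub 1
  set c := inner ℂ x (ContinuousLinearMap.adjoint (Q z₀) y)
  have h2 : Tendsto (fun n => (inner ℂ x (G (z n) y) - c * (z n)⁻¹) / (1 - conj z₀ * (z n)⁻¹)) atTop
      (𝓝 ((inner ℂ x (T y) - c * 0) / 1)) :=
    (hGz.sub (hinf.const_mul c)).div h1 one_ne_zero
  rw [mul_zero, sub_zero, div_one] at h2
  refine h2.congr' ?_
  filter_upwards [hzD, hz.eventually (Bornology.eventually_ne_cobounded (0 : ℂ)),
    h1.eventually_ne one_ne_zero] with n ⟨hn, hnQ⟩ hn0 hn1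
  have e := h.inner_apply hn (hzr n) x y
  rw [hnQ, smul_apply, inner_smul_right] at e
  rw [div_eq_iff hn1]
  field_simp
  linear_combination e

/-- There is a sequence tending to infinity inside the domain along which the defect vectors
converge in the weak sense. -/
theorem IsRepresentation.exists_sequence {κ : ℕ} {D₁ : Set ℂ} {Q₁ : ℂ → H →L[ℂ] H}
    (hQ : IsGenNevanlinna κ D₁ Q₁)
    (h : IsRepresentation (invDom D₁ Q₁) (negInv Q₁) J A Γ z₀) {G : ℂ → H →L[ℂ] H}
    {T : H →L[ℂ] H} (hG : Tendsto G (Bornology.cobounded ℂ) (𝓝 T))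
    (hev : ∀ᶠ z in Bornology.cobounded ℂ, z ∈ D₁ → IsUnit (Q₁ z) ∧ negInv Q₁ z = z • G z) :
    ∃ z : ℕ → ℂ, (∀ n, z n ∈ resSet A) ∧ Tendsto z atTop (Bornology.cobounded ℂ) ∧
      (∀ n, z n ≠ conj (z n)) ∧
      (∃ B : ℝ, ∀ n, ‖(conj (z n) - conj z₀) / (z n - conj (z n))‖ ≤ B) ∧
      ∀ x y : H,
        Tendsto (fun n => form J (Γ x) (defect A z₀ (z n) (Γ y))) atTop (𝓝 (inner ℂ x (T y))) ∧
        Tendsto (fun n => form J (Γ x) (defect A z₀ (conj (z n)) (Γ y))) atTop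
          (𝓝 (inner ℂ x (T y))) := by
  have hJ := h.isPontryagin
  have hA := h.isSelfAdjointRel
  have hfin := finite_upper_diff_resSet hJ hA h.mem_resSet h.im_pos
  have hex : ∀ n : ℕ, ∃ w : ℂ, w ∈ D₁ ∧ w ∈ resSet A ∧ (n : ℝ) + 1 ≤ w.im ∧ ‖w‖ ≤ n + 3 := by
    intro n
    -- A point w within distance 1 of i(n + 2) has Im w ≥ n + 1 and |w| ≤ n + 3. Hence |w| is
    -- comparable to Im w, which gives the bound B.
    set c : ℂ := ⟨0, n + 2⟩ with hc
    have hcim : c.im ≠ 0 := by simp only [hc]; positivity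
    have hcn : ‖c‖ = n + 2 := by
      have : c = ((n + 2 : ℝ) : ℂ) * Complex.I := by apply Complex.ext <;> simp [hc]
      rw [this, norm_mul, Complex.norm_I, mul_one, Complex.norm_real, Real.norm_of_nonneg]
      positivity
    have h1 := hQ.codiscrete c hcim
    have h2 : ∀ᶠ w in 𝓝[≠] c, w ∉ {z : ℂ | 0 < z.im ∧ z ∉ resSet A} :=
      nhdsNE_le_cofinite _ hfin.eventually_cofinite_notMem
    have h3 : ∀ᶠ w in 𝓝[≠] c, w ∈ Metric.ball c 1 :=
      nhdsWithin_le_nhds (Metric.ball_mem_nhds c one_pos)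
    obtain ⟨w, ⟨hw1, hw2⟩, hw3⟩ := ((h1.and h2).and h3).exists
    rw [Metric.mem_ball, dist_eq_norm] at hw3
    have him : (n : ℝ) + 1 ≤ w.im := by
      have := (Complex.abs_im_le_norm (w - c)).trans hw3.le
      rw [Complex.sub_im, abs_le] at this
      have hcc : c.im = n + 2 := rfl
      linarith [this.1]
    refine ⟨w, hw1, ?_, him, ?_⟩
    · by_contra hr
      exact hw2 ⟨lt_of_lt_of_le (by positivity) him, hr⟩
    · have := norm_sub_norm_le w c
      linarith
  choose z hzD hzr hzim hzn using hex
  have htend : Tendsto z atTop (Bornology.cobounded ℂ) := by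
    rw [← tendsto_norm_atTop_iff_cobounded]
    refine tendsto_atTop_mono (fun n => ?_) tendsto_natCast_atTop_atTop
    have := (le_abs_self _).trans (Complex.abs_im_le_norm (z n))
    linarith [hzim n]
  have htend' : Tendsto (fun n => conj (z n)) atTop (Bornology.cobounded ℂ) := by
    rw [← tendsto_norm_atTop_iff_cobounded] at htend ⊢
    simpa using htend
  have hpos : ∀ n, 0 < (z n).im := fun n => lt_of_lt_of_le (by positivity) (hzim n)
  refine ⟨z, hzr, htend, fun n hn => ?_, ⟨(3 + ‖z₀‖), fun n => ?_⟩, fun x y => ⟨?_, ?_⟩⟩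
  · have := congrArg Complex.im hn
    rw [Complex.conj_im] at this
    linarith [hpos n]
  · have e1 : ‖z n - conj (z n)‖ = 2 * (z n).im := by
      rw [Complex.sub_conj, norm_mul, Complex.norm_I, mul_one, Complex.norm_real,
        Real.norm_of_nonneg (by linarith [hpos n])]
    have e2 : ‖conj (z n) - conj z₀‖ ≤ n + 3 + ‖z₀‖ := by
      rw [← map_sub, Complex.norm_conj]
      exact (norm_sub_le _ _).trans (by linarith [hzn n])
    rw [norm_div, e1, div_le_iff₀ (by linarith [hpos n])]
    nlinarith [hzim n, norm_nonneg z₀, mul_nonneg (norm_nonneg z₀) (Nat.cast_nonneg (α := ℝ) n),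
      mul_le_mul_of_nonneg_left (hzim n) (norm_nonneg z₀)]
  · refine h.tendsto_form hG htend ?_ hzr x y
    filter_upwards [htend.eventually hev] with n hn
    exact ⟨⟨hzD n, (hn (hzD n)).1⟩, (hn (hzD n)).2⟩
  · refine h.tendsto_form hG htend' ?_ (fun n => conj_mem_resSet hJ hA (hzr n)) x y
    filter_upwards [htend'.eventually hev] with n hn
    have hD := (hQ.symm _ (hzD n)).1
    exact ⟨⟨hD, (hn hD).1⟩, (hn hD).2⟩

end Representation

/-! ### Negative eigenvalues and negative subspaces -/

theorem toENat_rank_le_of_injective {V W : Type*} [AddCommGroup V] [Module ℂ V] [AddCommGroup W]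
    [Module ℂ W] (f : V →ₗ[ℂ] W) (hf : Function.Injective f) :
    (Module.rank ℂ V).toENat ≤ (Module.rank ℂ W).toENat := by
  have h := Cardinal.toENat.monotone' (LinearMap.lift_rank_le_of_injective f hf)
  simpa using h

theorem inner_plusAdjoint_comp (J : K →L[ℂ] K) (C : H →L[ℂ] K) (x y : H) :
    inner ℂ x ((plusAdjoint J C).comp C y) = form J (C x) (C y) := by
  rw [ContinuousLinearMap.comp_apply, inner_plusAdjoint]

theorem IsPontryagin.inner_gram_symm {J : K →L[ℂ] K} (hJ : IsPontryagin J) (C : H →L[ℂ] K)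
    (x y : H) :
    inner ℂ ((plusAdjoint J C).comp C x) y = inner ℂ x ((plusAdjoint J C).comp C y) := by
  rw [← inner_conj_symm, inner_plusAdjoint_comp, inner_plusAdjoint_comp, hJ.conj_form]

/-- `Γ⁺Γ` is nonnegative as soon as it has no negative eigenvalues. -/
theorem IsPontryagin.re_form_nonneg_of_no_neg_eigenvalue {J : K →L[ℂ] K} (hJ : IsPontryagin J)
    (C : H →L[ℂ] K)
    (h : ∀ s : ℝ, s < 0 → ∀ x : H, (plusAdjoint J C).comp C x = (s : ℂ) • x → x = 0) (x : H) :
    0 ≤ (form J (C x) (C x)).re := by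
  have := hJ.finiteDimensional
  set S := (plusAdjoint J C).comp C with hS
  have hSA : IsSelfAdjoint S := by
    rw [ContinuousLinearMap.isSelfAdjoint_iff_isSymmetric]
    exact fun x y => hJ.inner_gram_symm C x y
  have hspec : ∀ s ∈ spectrum ℝ S, 0 ≤ s := by
    intro s hs
    by_contra! hs0
    refine (spectrum.mem_iff.1 hs) ?_
    rw [← IsUnit.neg_iff, neg_sub]
    -- Γ⁺Γ - s is a finite rank perturbation of C*C - s, which is bounded below by -s > 0. So a
    -- negative spectral point s must be an eigenvalue.
    set B : H →L[ℂ] H := (ContinuousLinearMap.adjoint C).comp C - (s : ℂ) • 1 with hB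
    have hBu : IsUnit B := by
      refine ContinuousLinearMap.isUnit_of_forall_le_norm_inner_map B (c := ⟨-s, by linarith⟩)
        (by exact_mod_cast neg_pos.2 hs0) fun x => ?_
      refine le_trans ?_ (RCLike.re_le_norm _)
      rw [hB, sub_apply, inner_sub_left, ContinuousLinearMap.comp_apply,
        ContinuousLinearMap.adjoint_inner_left, smul_apply, one_apply_eq_self, inner_smul_left,
        inner_self_eq_norm_sq_to_K, inner_self_eq_norm_sq_to_K]
      simp only [Complex.conj_ofReal, Complex.coe_algebraMap, ← Complex.ofReal_pow,
        ← Complex.ofReal_mul, ← Complex.ofReal_sub, RCLike.re_eq_complex_re, Complex.ofReal_re]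
      change ‖x‖ ^ 2 * -s ≤ _
      nlinarith [sq_nonneg ‖C x‖]
    have hJa : ContinuousLinearMap.adjoint J = J := hJ.isSelfAdjoint.adjoint_eq
    have key : S - algebraMap ℝ (H →L[ℂ] H) s
        = B + (-2 : ℂ) • ((ContinuousLinearMap.adjoint C).comp
            ((negPart J).starProjection.comp C)) := by
      ext y
      rw [Algebra.algebraMap_eq_smul_one, hS, hB, plusAdjoint, hJa]
      simp only [sub_apply, add_apply, ContinuousLinearMap.comp_apply, smul_apply,
        one_apply_eq_self, hJ.map_eq (C y), map_sub, map_smul]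
      rw [← Complex.coe_smul]
      module
    rw [key]
    refine isUnit_add_of_finiteRank hBu
      (V := (negPart J).map ((ContinuousLinearMap.adjoint C : K →L[ℂ] H) : K →ₗ[ℂ] H)) ?_ ?_
    · intro y
      exact Submodule.smul_mem _ _ (Submodule.mem_map_of_mem
        (Submodule.starProjection_apply_mem _ _))
    · intro y hy
      have h1 := congrArg (fun T : H →L[ℂ] H => T y) key
      have h2 : S y - s • y = 0 := by
        refine Eq.trans ?_ (h1.trans hy)
        simp [Algebra.algebraMap_eq_smul_one]
      exact h s hs0 y (by rw [Complex.coe_smul]; exact sub_eq_zero.1 h2)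
  have hr : SpectrumRestricts S ContinuousMap.realToNNReal := SpectrumRestricts.nnreal_iff.2 hspec
  obtain ⟨p, hp1, -, hp3⟩ := CFC.exists_sqrt_of_isSelfAdjoint_of_quasispectrumRestricts hSA hr
  have hp : inner ℂ x (S x) = inner ℂ (p x) (p x) := by
    have hpS := hp1.adjoint_eq
    rw [← hp3, mul_apply_eq_comp, ← ContinuousLinearMap.adjoint_inner_left, hpS]
  rw [← inner_plusAdjoint_comp, ← hS, hp]
  exact inner_self_nonneg (𝕜 := ℂ)

/-- The sum of the eigenspaces to negative eigenvalues. -/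
noncomputable def negSpectralSubspace (T : H →L[ℂ] H) : Submodule ℂ H :=
  ⨆ (t : ℝ) (_ : t < 0), Module.End.eigenspace (T : H →ₗ[ℂ] H) (t : ℂ)

theorem mem_negSpectralSubspace {T : H →L[ℂ] H} {t : ℝ} (ht : t < 0) {x : H}
    (hx : T x = (t : ℂ) • x) : x ∈ negSpectralSubspace T :=
  Submodule.mem_iSup_of_mem t (Submodule.mem_iSup_of_mem ht (Module.End.mem_eigenspace_iff.2 hx))

theorem map_mem_negSpectralSubspace {T : H →L[ℂ] H} {x : H} (hx : x ∈ negSpectralSubspace T) :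
    T x ∈ negSpectralSubspace T := by
  have : negSpectralSubspace T ≤ (negSpectralSubspace T).comap (T : H →ₗ[ℂ] H) := by
    refine iSup₂_le fun t ht y hy => ?_
    have hy' : T y = (t : ℂ) • y := Module.End.mem_eigenspace_iff.1 hy
    change T y ∈ negSpectralSubspace T
    rw [hy']
    exact Submodule.smul_mem _ _ (mem_negSpectralSubspace ht hy')
  exact this hx

/-- Eigenvectors to different eigenvalues are orthogonal, so (x, Tx) is the sum of t‖x_t‖² over the
eigencomponents of x. -/
theorem re_inner_neg_of_mem_negSpectralSubspace {T : H →L[ℂ] H}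
    (hT : (T : H →ₗ[ℂ] H).IsSymmetric) {x : H} (hx : x ∈ negSpectralSubspace T) (hx0 : x ≠ 0) :
    (inner ℂ x (T x)).re < 0 := by
  rw [negSpectralSubspace, iSup_subtype', Submodule.mem_iSup_iff_exists_finsupp] at hx
  obtain ⟨f, hf, rfl⟩ := hx
  have hfT : ∀ i, T (f i) = ((i : ℝ) : ℂ) • f i := fun i => Module.End.mem_eigenspace_iff.1 (hf i)
  have hTx : T (∑ i ∈ f.support, f i) = ∑ i ∈ f.support, ((i : ℝ) : ℂ) • f i := by
    rw [map_sum]; exact Finset.sum_congr rfl fun i _ => hfT i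
  have horth : ∀ i j, i ≠ j → inner ℂ (f i) (f j) = 0 := by
    intro i j hij
    have h1 : inner ℂ (T (f i)) (f j) = inner ℂ (f i) (T (f j)) := hT (f i) (f j)
    rw [hfT, hfT, inner_smul_left, inner_smul_right, Complex.conj_ofReal, ← sub_eq_zero,
      ← sub_mul] at h1
    refine (mul_eq_zero.1 h1).resolve_left fun h => hij ?_
    exact Subtype.ext (by exact_mod_cast sub_eq_zero.1 h)
  have hsum : inner ℂ (∑ i ∈ f.support, f i) (∑ i ∈ f.support, ((i : ℝ) : ℂ) • f i)
      = ((∑ i ∈ f.support, (i : ℝ) * ‖f i‖ ^ 2 : ℝ) : ℂ) := by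
    rw [sum_inner, Complex.ofReal_sum]
    refine Finset.sum_congr rfl fun i hi => ?_
    rw [inner_sum, Finset.sum_eq_single i]
    · rw [inner_smul_right, inner_self_eq_norm_sq_to_K]; simp
    · intro j _ hj
      rw [inner_smul_right, horth i j hj.symm, mul_zero]
    · exact fun h => absurd hi h
  change (inner ℂ (∑ i ∈ f.support, f i) (T (∑ i ∈ f.support, f i))).re < 0
  rw [hTx, hsum, Complex.ofReal_re]
  refine Finset.sum_neg (fun i hi => ?_) ?_
  · exact mul_neg_of_neg_of_pos i.2 (pow_pos (norm_pos_iff.2 (Finsupp.mem_support_iff.1 hi)) 2)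
  · by_contra hne
    rw [Finset.not_nonempty_iff_eq_empty] at hne
    exact hx0 (by rw [Finsupp.sum, hne, Finset.sum_empty])

/-- Subspaces on which the form `(x, S⁻¹ x)`, `S = Γ⁺Γ`, is negative definite have at most the
dimension of the sum of the eigenspaces to negative eigenvalues. -/
theorem IsPontryagin.toENat_rank_le_numNegEigenvalues {J : K →L[ℂ] K} (hJ : IsPontryagin J)
    {C : H →L[ℂ] K} {T : H →L[ℂ] H} (hST : ∀ x, (plusAdjoint J C).comp C (T x) = x)
    (hTS : ∀ x, T ((plusAdjoint J C).comp C x) = x)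
    {N : Submodule ℂ H} (hN : ∀ x ∈ N, x ≠ 0 → (inner ℂ x (T x)).re < 0) :
    (Module.rank ℂ N).toENat ≤ numNegEigenvalues T := by
  change _ ≤ (Module.rank ℂ (negSpectralSubspace T)).toENat
  set S := (plusAdjoint J C).comp C with hS
  set L := negSpectralSubspace T with hL
  have hTsymm : ∀ x y, inner ℂ (T x) y = inner ℂ x (T y) := by
    intro x y
    have := hJ.inner_gram_symm C (T x) (T y)
    rw [← hS, hST, hST] at this
    exact this.symm
  by_cases hfin : FiniteDimensional ℂ L
  swap
  · have : (Module.rank ℂ L).toENat = ⊤ := by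
      rw [Cardinal.toENat_eq_top]
      by_contra hlt
      exact hfin (Module.rank_lt_aleph0_iff.1 (not_le.1 hlt))
    rw [this]; exact le_top
  have hTperp : ∀ x ∈ Lᗮ, T x ∈ Lᗮ := by
    intro x hx y hy
    rw [← hTsymm]
    exact hx _ (map_mem_negSpectralSubspace hy)
  -- The Gram operator of C' is the compression of S to Lᗮ. As T maps the finite-dimensional L onto
  -- itself, S preserves Lᗮ. An eigenvector of the compression to a negative eigenvalue is thus one
  -- of S and of T, so it lies in L ∩ Lᗮ = 0.
  let C' : Lᗮ →L[ℂ] K := C ∘L Lᗮ.subtypeL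
  have hpos : ∀ y ∈ Lᗮ, 0 ≤ (form J (C y) (C y)).re := by
    intro y hy
    refine hJ.re_form_nonneg_of_no_neg_eigenvalue C' (fun s hs u hu => ?_) ⟨y, hy⟩
    have hSu : S u = (s : ℂ) • (u : H) := by
      have hSperp : S u ∈ Lᗮ := by
        intro l hl
        have h1 : l ∈ L.map (T : H →ₗ[ℂ] H) := by
          have hle : L.map (T : H →ₗ[ℂ] H) ≤ L := by
            rintro _ ⟨w, hw, rfl⟩
            exact map_mem_negSpectralSubspace hw
          have hTi : Function.Injective (T : H →ₗ[ℂ] H) := fun a b hab => by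
            rw [← hST a, ← hST b]; exact congrArg S hab
          have := Submodule.eq_of_le_of_finrank_eq hle
            (L.equivMapOfInjective _ hTi).finrank_eq.symm
          rw [this]; exact hl
        obtain ⟨w, hw, rfl⟩ := h1
        change inner ℂ (T w) (S u) = 0
        rw [hTsymm, hTS]
        exact u.2 w hw
      refine ext_inner_left ℂ fun v => ?_
      have h2 := L.starProjection_add_starProjection_orthogonal v
      rw [← h2, inner_add_left, inner_add_left,
        hSperp _ (Submodule.starProjection_apply_mem _ _),
        (Lᗮ.smul_mem (s : ℂ) u.2) _ (Submodule.starProjection_apply_mem _ _)]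
      congr 1
      have h3 := congrArg (fun w => inner ℂ (Lᗮ.orthogonalProjectionOnto v) w) hu
      simp only [inner_plusAdjoint_comp] at h3
      rw [hS, inner_plusAdjoint_comp]
      exact h3
    have hTu : T u = ((s⁻¹ : ℝ) : ℂ) • (u : H) := by
      have := congrArg T hSu
      rw [hTS, map_smul] at this
      rw [Complex.ofReal_inv, eq_inv_smul_iff₀ (by exact_mod_cast hs.ne)]
      exact this.symm
    have huL : (u : H) ∈ L := mem_negSpectralSubspace (inv_lt_zero.2 hs) hTu
    exact Subtype.ext (inner_self_eq_zero.1 (u.2 _ huL))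
  -- Projection onto L is injective on N: for x in N ∩ Lᗮ one has (x, Tx) = [CTx, CTx] ≥ 0.
  refine toENat_rank_le_of_injective (L.orthogonalProjectionOnto.toLinearMap ∘ₗ N.subtype) ?_
  rw [← LinearMap.ker_eq_bot, LinearMap.ker_eq_bot']
  intro x hx
  have hx' : L.orthogonalProjectionOnto (x : H) = 0 := hx
  have hxL : (x : H) ∈ Lᗮ := by
    rwa [Submodule.orthogonalProjectionOnto_eq_zero_iff] at hx'
  by_contra hne
  have h1 := hN x x.2 fun h => hne (Subtype.ext h)
  have h2 := hpos _ (hTperp _ hxL)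
  rw [← inner_plusAdjoint_comp, ← hS, hST, hTsymm] at h2
  linarith

/-- Transport of negative subspaces along a surjection which preserves the forms. -/
theorem IsPontryagin.negIndex_eq_numNegEigenvalues {J : K →L[ℂ] K} (hJ : IsPontryagin J)
    {C : H →L[ℂ] K} {T : H →L[ℂ] H} (hST : ∀ x, (plusAdjoint J C).comp C (T x) = x)
    (hTS : ∀ x, T ((plusAdjoint J C).comp C x) = x)
    {J' : K' →L[ℂ] K'} {K₁ : Submodule ℂ K'} (L : K₁ →ₗ[ℂ] H) (hL : Function.Surjective L)
    (hform : ∀ x : K₁, form J' x x = inner ℂ (L x) (T (L x))) :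
    negIndex J' K₁ = numNegEigenvalues T := by
  apply le_antisymm
  · refine iSup_le fun N => iSup_le fun hNK => iSup_le fun hN => ?_
    let LN : N →ₗ[ℂ] H := L ∘ₗ Submodule.inclusion hNK
    have hLN : ∀ x : N, x ≠ 0 → (inner ℂ (LN x) (T (LN x))).re < 0 := by
      intro x hx
      have h1 := hN x x.2 fun h => hx (Subtype.ext h)
      have h2 := hform ⟨x, hNK x.2⟩
      simp only at h2
      rw [h2] at h1
      exact h1
    have hinj : Function.Injective LN := by
      rw [← LinearMap.ker_eq_bot, LinearMap.ker_eq_bot']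
      intro x hx
      by_contra hne
      have := hLN x hne
      rw [hx] at this
      simp at this
    refine (toENat_rank_le_of_injective LN.rangeRestrict ?_).trans
      (hJ.toENat_rank_le_numNegEigenvalues hST hTS (N := LinearMap.range LN) ?_)
    · exact fun a b hab => hinj (congrArg Subtype.val hab)
    · rintro _ ⟨x, rfl⟩ hx
      exact hLN x fun h => hx (by rw [h, map_zero])
  · have hTsymm : (T : H →ₗ[ℂ] H).IsSymmetric := by
      intro x y
      have := hJ.inner_gram_symm C (T x) (T y)
      rw [hST, hST] at this
      exact this.symm
    -- A linear section of L carries the negative spectral subspace into K₁ with its form preserved.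
    obtain ⟨s, hs⟩ := L.exists_rightInverse_of_surjective (LinearMap.range_eq_top.2 hL)
    have hs' : ∀ x, L (s x) = x := fun x => congrArg (fun f : H →ₗ[ℂ] H => f x) hs
    let s' : H →ₗ[ℂ] K' := K₁.subtype ∘ₗ s
    have hs'inj : Function.Injective s' := fun a b hab => by
      rw [← hs' a, ← hs' b, Subtype.ext hab]
    have hneg : ∀ x ∈ (negSpectralSubspace T).map s', x ≠ 0 → (form J' x x).re < 0 := by
      rintro _ ⟨x, hx, rfl⟩ hx0
      change (form J' (s x : K') (s x)).re < 0
      rw [hform, hs']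
      exact re_inner_neg_of_mem_negSpectralSubspace hTsymm hx fun h => hx0 (by rw [h, map_zero])
    have hle : (negSpectralSubspace T).map s' ≤ K₁ := by
      rintro _ ⟨x, hx, rfl⟩
      exact (s x).2
    refine le_trans ?_ (le_iSup_of_le ((negSpectralSubspace T).map s')
      (le_iSup_of_le hle (le_iSup_of_le hneg le_rfl)))
    refine toENat_rank_le_of_injective (s'.submoduleMap (negSpectralSubspace T)) ?_
    intro a b hab
    have h := congrArg (fun w : (negSpectralSubspace T).map s' => (w : K')) hab
    exact Subtype.ext (hs'inj h)

/-! ### The span of the defect vectors and the limit at infinity -/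

section DefectSpace

variable {J : K →L[ℂ] K} {A : LinRel K} {Γ : H →L[ℂ] K} {z₀ : ℂ}

/-- The defect vectors `(1 + (z - z₀)(A - z)⁻¹) Γ h`. -/
def defectVectors (A : LinRel K) (Γ : H →L[ℂ] K) (z₀ : ℂ) : Set K :=
  {k : K | ∃ z ∈ resSet A, ∃ h : H, k = (1 + (z - z₀) • res A z) (Γ h)}

/-- The closed linear span of the defect vectors. -/
noncomputable def defectSpace (A : LinRel K) (Γ : H →L[ℂ] K) (z₀ : ℂ) : Submodule ℂ K :=
  (Submodule.span ℂ (defectVectors A Γ z₀)).topologicalClosure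

theorem isClosed_defectSpace : IsClosed (defectSpace A Γ z₀ : Set K) :=
  Submodule.isClosed_topologicalClosure _

theorem defect_mem_defectVectors {z : ℂ} (hz : z ∈ resSet A) (h : H) :
    defect A z₀ z (Γ h) ∈ defectVectors A Γ z₀ := ⟨z, hz, h, rfl⟩

theorem defect_mem_defectSpace {z : ℂ} (hz : z ∈ resSet A) (h : H) :
    defect A z₀ z (Γ h) ∈ defectSpace A Γ z₀ :=
  Submodule.le_topologicalClosure _ (Submodule.subset_span (defect_mem_defectVectors hz h))

theorem apply_mem_defectSpace (h₀ : z₀ ∈ resSet A) (h : H) : Γ h ∈ defectSpace A Γ z₀ := by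
  simpa only [defect_self] using defect_mem_defectSpace (Γ := Γ) (z₀ := z₀) h₀ h

/-- For w ≠ v, R_v e_w is a multiple of e_w - e_v. The case w = v follows by letting u → v in R_v
e_u, as the space is closed. -/
theorem res_mem_defectSpace {v : ℂ} (hv : v ∈ resSet A) {x : K} (hx : x ∈ defectSpace A Γ z₀) :
    res A v x ∈ defectSpace A Γ z₀ := by
  set M := defectSpace A Γ z₀
  have hne : ∀ w ∈ resSet A, ∀ h, w ≠ v → res A v (defect A z₀ w (Γ h)) ∈ M := by
    intro w hw h hwv
    have h1 := smul_res_defect (z₀ := z₀) hv hw (Γ h)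
    have h2 : res A v (defect A z₀ w (Γ h))
        = (w - v)⁻¹ • (defect A z₀ w (Γ h) - defect A z₀ v (Γ h)) := by
      rw [← h1, inv_smul_smul₀ (sub_ne_zero.2 hwv)]
    rw [h2]
    exact M.smul_mem _ (M.sub_mem (defect_mem_defectSpace hw h) (defect_mem_defectSpace hv h))
  have hgen : ∀ w ∈ resSet A, ∀ h, res A v (defect A z₀ w (Γ h)) ∈ M := by
    intro w hw h
    rcases eq_or_ne w v with rfl | hwv
    · obtain ⟨hev, ht⟩ := tendsto_res hw
      have hcont : Tendsto (fun u => res A w (defect A z₀ u (Γ h))) (𝓝[≠] w)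
          (𝓝 (res A w (defect A z₀ w (Γ h)))) := by
        refine ((res A w).continuous.tendsto _).comp ?_
        refine Tendsto.mono_left ?_ nhdsWithin_le_nhds
        simp only [defect_apply]
        have h1 : Tendsto (fun u => res A u (Γ h)) (𝓝 w) (𝓝 (res A w (Γ h))) :=
          ((ContinuousLinearMap.apply ℂ K (Γ h)).continuous.tendsto _).comp ht
        have h2 : Tendsto (fun u : ℂ => u - z₀) (𝓝 w) (𝓝 (w - z₀)) :=
          tendsto_id.sub_const z₀
        exact (h2.smul h1).const_add _
      refine isClosed_defectSpace.mem_of_tendsto hcont ?_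
      filter_upwards [nhdsWithin_le_nhds hev, self_mem_nhdsWithin] with u hu huw
      have h1 := smul_res_defect (z₀ := z₀) hw hu (Γ h)
      have h2 : res A w (defect A z₀ u (Γ h))
          = (u - w)⁻¹ • (defect A z₀ u (Γ h) - defect A z₀ w (Γ h)) := by
        rw [← h1, inv_smul_smul₀ (sub_ne_zero.2 huw)]
      rw [h2]
      exact M.smul_mem _ (M.sub_mem (defect_mem_defectSpace hu h) (defect_mem_defectSpace hw h))
    · exact hne w hw h hwv
  have hle : Submodule.span ℂ (defectVectors A Γ z₀) ≤ M.comap (res A v : K →ₗ[ℂ] K) := by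
    rw [Submodule.span_le]
    rintro _ ⟨w, hw, h, rfl⟩
    exact hgen w hw h
  have hcl : IsClosed ((M.comap (res A v : K →ₗ[ℂ] K) : Submodule ℂ K) : Set K) :=
    (isClosed_defectSpace (A := A) (Γ := Γ) (z₀ := z₀)).preimage (res A v).continuous
  exact Submodule.topologicalClosure_minimal _ hle hcl hx

theorem res_mem_isotropicPart (hJ : IsPontryagin J) (hA : IsSelfAdjointRel J A) {v : ℂ}
    (hv : v ∈ resSet A) {x : K} (hx : x ∈ isotropicPart J (defectSpace A Γ z₀)) :
    res A v x ∈ isotropicPart J (defectSpace A Γ z₀) := by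
  refine ⟨res_mem_defectSpace hv hx.1, fun y hy => ?_⟩
  rw [← form_res_left hJ hA hv]
  exact hx.2 _ (res_mem_defectSpace (conj_mem_resSet hJ hA hv) hy)

/-- Expresses [e_w x, e_z y] through forms with x on the left, which the representation controls at
infinity. For w = z the coefficient is the quotient bounded in `IsRepresentation.exists_sequence`.
-/
theorem form_defect_defect (hJ : IsPontryagin J) (hA : IsSelfAdjointRel J A) {w z : ℂ}
    (hw : w ∈ resSet A) (hz : z ∈ resSet A) (hne : z ≠ conj w) (x y : K) :
    form J (defect A z₀ w x) (defect A z₀ z y) = form J x (defect A z₀ z y)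
      + (conj w - conj z₀) / (z - conj w) *
        (form J x (defect A z₀ z y) - form J x (defect A z₀ (conj w) y)) := by
  have h1 := congrArg (form J x) (smul_res_defect (z₀ := z₀) (conj_mem_resSet hJ hA hw) hz y)
  rw [form_smul_right, form_sub_right] at h1
  rw [form_defect_left hJ hA hw, ← h1]
  have : z - conj w ≠ 0 := sub_ne_zero.2 hne
  field_simp

/-- The weak limits of the defect vectors at infinity. -/
theorem exists_limit_vectors (hJ : IsPontryagin J) (hA : IsSelfAdjointRel J A) {T : H →L[ℂ] H}
    {z : ℕ → ℂ} (hz : ∀ n, z n ∈ resSet A) (htend : Tendsto z atTop (Bornology.cobounded ℂ))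
    (hne : ∀ n, z n ≠ conj (z n))
    (hB : ∃ B : ℝ, ∀ n, ‖(conj (z n) - conj z₀) / (z n - conj (z n))‖ ≤ B)
    (hlim : ∀ x y : H,
      Tendsto (fun n => form J (Γ x) (defect A z₀ (z n) (Γ y))) atTop (𝓝 (inner ℂ x (T y))) ∧
      Tendsto (fun n => form J (Γ x) (defect A z₀ (conj (z n)) (Γ y))) atTop
        (𝓝 (inner ℂ x (T y)))) :
    ∃ p : H → K, (∀ h, p h ∈ defectSpace A Γ z₀) ∧
      (∀ w ∈ resSet A, ∀ g h, form J (defect A z₀ w (Γ g)) (p h) = inner ℂ g (T h)) ∧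
      (∀ g h, form J (p g) (p h) = inner ℂ g (T h)) ∧
      ∀ v ∈ resSet A, ∀ h, res A v (p h) ∈ isotropicPart J (defectSpace A Γ z₀) := by
  have hinv : ∀ a : ℂ, Tendsto (fun n => (z n - a)⁻¹) atTop (𝓝 0) := by
    intro a
    refine tendsto_inv₀_cobounded.comp ?_
    rw [← tendsto_norm_atTop_iff_cobounded] at htend ⊢
    refine tendsto_atTop_mono (fun n => norm_sub_norm_le (z n) a) ?_
    exact tendsto_atTop_add_const_right _ _ htend
  have hnea : ∀ a : ℂ, ∀ᶠ n in atTop, z n ≠ a := fun a =>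
    htend.eventually (Bornology.eventually_ne_cobounded a)
  have hw : ∀ w ∈ resSet A, ∀ g h,
      Tendsto (fun n => form J (defect A z₀ w (Γ g)) (defect A z₀ (z n) (Γ h))) atTop
        (𝓝 (inner ℂ g (T h))) := by
    intro w hw g h
    have h1 := (hlim g h).1
    have h2 := h1.add (((hinv (conj w)).const_mul (conj w - conj z₀)).mul
      (h1.sub_const (form J (Γ g) (defect A z₀ (conj w) (Γ h)))))
    rw [mul_zero, zero_mul, add_zero] at h2
    refine h2.congr' ?_
    filter_upwards [hnea (conj w)] with n hn
    rw [form_defect_defect hJ hA hw (hz n) hn, div_eq_mul_inv]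
  have hbound : ∀ h, ∃ B : ℝ, ∀ n,
      (form J (defect A z₀ (z n) (Γ h)) (defect A z₀ (z n) (Γ h))).re ≤ B := by
    intro h
    obtain ⟨B, hB⟩ := hB
    obtain ⟨C, hC⟩ := (Metric.isBounded_range_of_tendsto _ (hlim h h).1).exists_norm_le
    obtain ⟨C', hC'⟩ := (Metric.isBounded_range_of_tendsto _ (hlim h h).2).exists_norm_le
    refine ⟨C + B * (C + C'), fun n => (Complex.re_le_norm _).trans ?_⟩
    have h1 := hC _ ⟨n, rfl⟩
    have h2 := hC' _ ⟨n, rfl⟩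
    simp only at h1 h2
    rw [form_defect_defect hJ hA (hz n) (hz n) (hne n)]
    refine (norm_add_le _ _).trans (add_le_add h1 ?_)
    rw [norm_mul]
    exact mul_le_mul (hB n) ((norm_sub_le _ _).trans (add_le_add h1 h2)) (norm_nonneg _)
      ((norm_nonneg _).trans (hB n))
  have hex : ∀ h, ∃ q ∈ defectSpace A Γ z₀, ∀ y ∈ defectSpace A Γ z₀,
      Tendsto (fun n => form J y (defect A z₀ (z n) (Γ h))) atTop (𝓝 (form J y q)) := by
    intro h
    obtain ⟨B, hB'⟩ := hbound h
    refine exists_form_limit hJ isClosed_defectSpace (E := defectVectors A Γ z₀) rfl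
      (fun n => defect_mem_defectSpace (hz n) h) hB' ?_
    rintro _ ⟨w, hw', g, rfl⟩
    exact ⟨_, hw w hw' g h⟩
  choose p hpM hp using hex
  have h2 : ∀ w ∈ resSet A, ∀ g h, form J (defect A z₀ w (Γ g)) (p h) = inner ℂ g (T h) :=
    fun w hw' g h => tendsto_nhds_unique (hp h _ (defect_mem_defectSpace hw' g)) (hw w hw' g h)
  refine ⟨p, hpM, h2, fun g h => ?_, fun v hv h => ⟨res_mem_defectSpace hv (hpM h), ?_⟩⟩
  · have h3 := (Complex.continuous_conj.tendsto _).comp (hp g (p h) (hpM h))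
    simp only [Function.comp_def, hJ.conj_form] at h3
    exact tendsto_nhds_unique h3 (tendsto_const_nhds.congr fun n => (h2 _ (hz n) g h).symm)
  · refine form_eq_zero_of_dense (E := defectVectors A Γ z₀) rfl ?_
    rintro _ ⟨w, hw', g, rfl⟩
    change form J (defect A z₀ w (Γ g)) (res A v (p h)) = 0
    rw [← form_res_left hJ hA hv]
    have hv' := conj_mem_resSet hJ hA hv
    refine tendsto_nhds_unique (hp h _ (res_mem_defectSpace hv' (defect_mem_defectSpace hw' g))) ?_
    have h3 := (hinv v).mul ((hw w hw' g h).sub_const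
      (form J (defect A z₀ w (Γ g)) (defect A z₀ v (Γ h))))
    rw [zero_mul] at h3
    refine h3.congr' ?_
    filter_upwards [hnea v] with n hn
    have h4 := congrArg (form J (defect A z₀ w (Γ g)))
      (smul_res_defect (z₀ := z₀) hv (hz n) (Γ h))
    rw [form_smul_right, form_sub_right] at h4
    rw [form_res_left hJ hA hv, ← h4, inv_mul_cancel_left₀ (sub_ne_zero.2 hn)]

/-- The vectors of `defectSpace` which are mapped to the isotropic part by all resolvents; for
minimal representations this is the multivalued part of `A`. -/
noncomputable def multivaluedPart (J : K →L[ℂ] K) (A : LinRel K) (Γ : H →L[ℂ] K) (z₀ : ℂ) :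
    Submodule ℂ K :=
  defectSpace A Γ z₀ ⊓
    ⨅ v : resSet A, (isotropicPart J (defectSpace A Γ z₀)).comap (res A v : K →ₗ[ℂ] K)

theorem mem_multivaluedPart {x : K} : x ∈ multivaluedPart J A Γ z₀ ↔ x ∈ defectSpace A Γ z₀ ∧
    ∀ v ∈ resSet A, res A v x ∈ isotropicPart J (defectSpace A Γ z₀) := by
  simp [multivaluedPart, Submodule.mem_iInf]

theorem isClosed_multivaluedPart : IsClosed (multivaluedPart J A Γ z₀ : Set K) := by
  rw [multivaluedPart, Submodule.coe_inf, Submodule.coe_iInf]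
  exact isClosed_defectSpace.inter (isClosed_iInter fun v =>
    (isClosed_isotropicPart isClosed_defectSpace).preimage (res A v).continuous)

theorem isInvariant_multivaluedPart (hJ : IsPontryagin J) (hA : IsSelfAdjointRel J A) :
    IsInvariant A (multivaluedPart J A Γ z₀) := by
  intro v hv x hx
  rw [mem_multivaluedPart] at hx ⊢
  exact ⟨(hx.2 v hv).1, fun w hw => res_mem_isotropicPart hJ hA hw (hx.2 v hv)⟩

end DefectSpace

end PontryaginRep

/-! ### The main theorem -/

theorem corollary3
    {H K K' : Type*}
    [NormedAddCommGroup H] [InnerProductSpace ℂ H] [CompleteSpace H] [Nontrivial H]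
    [NormedAddCommGroup K] [InnerProductSpace ℂ K] [CompleteSpace K]
    [NormedAddCommGroup K'] [InnerProductSpace ℂ K'] [CompleteSpace K']
    -- the function `Q ∈ N_κ(H)`, with domain `D`
    (κ : ℕ) (D : Set ℂ) (Q : ℂ → H →L[ℂ] H)
    (hQ : PontryaginRep.IsGenNevanlinna κ D Q)
    -- `Q(z) = Γ₀⁺ (A - z)⁻¹ Γ₀`, with `A` bounded and self-adjoint in the Pontryagin space `K`
    (J : K →L[ℂ] K) (hJ : PontryaginRep.IsPontryagin J)
    (A : K →L[ℂ] K) (hA : PontryaginRep.IsSelfAdjointOp J A)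
    (Γ₀ : H →L[ℂ] K)
    (hrep : ∀ z ∈ D, IsUnit (A - z • (1 : K →L[ℂ] K)) →
      Q z = (PontryaginRep.plusAdjoint J Γ₀).comp
        ((Ring.inverse (A - z • (1 : K →L[ℂ] K))).comp Γ₀))
    -- `Γ₀⁺ Γ₀` is boundedly invertible
    (hΓ₀ : IsUnit ((PontryaginRep.plusAdjoint J Γ₀).comp Γ₀))
    -- a representing triplet `(K', A', Γ')` of `Q̂ = -Q⁻¹`
    (J' : K' →L[ℂ] K') (A' : PontryaginRep.LinRel K') (Γ' : H →L[ℂ] K') (z₀ : ℂ)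
    (hrep' : PontryaginRep.IsRepresentation (PontryaginRep.invDom D Q) (PontryaginRep.negInv Q)
      J' A' Γ' z₀) :
    ¬ PontryaginRep.IsOperator A' ∧
    ∃ K₁ : Submodule ℂ K',
      IsClosed (K₁ : Set K') ∧
      PontryaginRep.IsInvariant A' K₁ ∧
      PontryaginRep.negIndex J' K₁ =
        PontryaginRep.numNegEigenvalues
          (Ring.inverse ((PontryaginRep.plusAdjoint J Γ₀).comp Γ₀)) ∧
      -- for minimal representations, moreover, `K₁` is a Pontryagin subspace and `A' K₁ ⊆ K₁`
      (PontryaginRep.IsMinimal A' Γ' z₀ →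
        PontryaginRep.IsNondegenerate J' K₁ ∧
        ∀ x ∈ K₁, ∀ y : K', (x, y) ∈ A' → y ∈ K₁) := by
  
  open PontryaginRep in
  have hJ' := hrep'.isPontryagin
  have hA' := hrep'.isSelfAdjointRel
  have h₀ := hrep'.mem_resSet
  set S := (plusAdjoint J Γ₀).comp Γ₀ with hS
  set T := Ring.inverse S with hT
  have hST : ∀ x, S (T x) = x := fun x => by
    rw [← mul_apply_eq_comp, Ring.mul_inverse_cancel _ hΓ₀]; rfl
  have hTS : ∀ x, T (S x) = x := fun x => by
    rw [← mul_apply_eq_comp, Ring.inverse_mul_cancel _ hΓ₀]; rfl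
  obtain ⟨G, hG, hev⟩ := negInv_asymptotics hrep hΓ₀
  obtain ⟨z, hz, htend, hne, hB, hlim⟩ := hrep'.exists_sequence hQ hG hev
  obtain ⟨p, hpM, hpdef, hpp, hpres⟩ := exists_limit_vectors hJ' hA' hz htend hne hB hlim
  set M := defectSpace A' Γ' z₀ with hM
  set O := isotropicPart J' M with hO
  set K₁ := multivaluedPart J' A' Γ' z₀ with hK₁
  have hpK : ∀ h, p h ∈ K₁ := fun h => mem_multivaluedPart.2 ⟨hpM h, fun v hv => hpres v hv h⟩
  let L : K₁ →ₗ[ℂ] H := (S ∘L plusAdjoint J' Γ').toLinearMap ∘ₗ K₁.subtype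
  have hLdef : ∀ x : K₁, T (L x) = plusAdjoint J' Γ' x := fun x => hTS _
  -- Since the resolvents map x into O, [e_w g, x] reduces to [Γ̂g, x] = (g, T(Lx)), which is also
  -- [e_w g, p(Lx)].
  have hdiff : ∀ x : K₁, (x : K') - p (L x) ∈ O := by
    intro x
    have hx := mem_multivaluedPart.1 x.2
    refine ⟨M.sub_mem hx.1 (hpM _), form_eq_zero_of_dense (E := defectVectors A' Γ' z₀) rfl ?_⟩
    rintro _ ⟨w, hw, g, rfl⟩
    change form J' (defect A' z₀ w (Γ' g)) _ = 0
    rw [form_sub_right, hpdef w hw, form_defect_left hJ' hA' hw,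
      (hx.2 _ (conj_mem_resSet hJ' hA' hw)).2 _ (apply_mem_defectSpace h₀ g), hLdef,
      inner_plusAdjoint, mul_zero, add_zero, sub_self]
  have hformL : ∀ x : K₁, form J' x x = inner ℂ (L x) (T (L x)) := by
    intro x
    have h1 := hdiff x
    have h2 := h1.2 _ (mem_multivaluedPart.1 x.2).1
    have h3 := hJ'.form_eq_zero_comm (h1.2 _ (hpM (L x)))
    rw [form_sub_right, sub_eq_zero] at h2
    rw [form_sub_left, sub_eq_zero] at h3
    rw [h2, h3, hpp]
  have hLp : ∀ h, L ⟨p h, hpK h⟩ = h := by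
    intro h
    have h1 : T (L ⟨p h, hpK h⟩) = T h := by
      rw [hLdef]
      refine ext_inner_left ℂ fun g => ?_
      rw [inner_plusAdjoint, ← hpdef z₀ h₀, defect_self]
    rw [← hST (L _), h1, hST]
  have hzero_of_mem : ∀ h, p h ∈ O → h = 0 := by
    intro h hh
    have h1 : T h = 0 := by
      refine ext_inner_left ℂ fun g => ?_
      rw [← hpp, hh.2 _ (hpM g), inner_zero_right]
    rw [← hST h, h1, map_zero]
  refine ⟨fun hop => ?_, K₁, isClosed_multivaluedPart, isInvariant_multivaluedPart hJ' hA',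
    hJ.negIndex_eq_numNegEigenvalues hST hTS L (fun h => ⟨_, hLp h⟩) hformL, fun hmin => ?_⟩
  · have hinj : ∀ u, res A' z₀ u = 0 → u = 0 := by
      intro u hu
      have h1 := res_mem h₀ u
      rw [hu, smul_zero, add_zero] at h1
      exact hop 0 u 0 h1 A'.zero_mem
    have hfin : FiniteDimensional ℂ O := hJ'.finiteDimensional_isotropicPart
    let R : O →ₗ[ℂ] O := (res A' z₀ : K' →ₗ[ℂ] K').restrict
      fun x hx => res_mem_isotropicPart hJ' hA' h₀ hx
    have hRi : Function.Injective R := by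
      rw [← LinearMap.ker_eq_bot, LinearMap.ker_eq_bot']
      exact fun x hx => Subtype.ext (hinj x (congrArg Subtype.val hx))
    obtain ⟨h, hh⟩ := exists_ne (0 : H)
    obtain ⟨m, hm⟩ := LinearMap.injective_iff_surjective.1 hRi ⟨_, hpres z₀ h₀ h⟩
    have hm' : res A' z₀ m = res A' z₀ (p h) := congrArg Subtype.val hm
    have h1 : p h = m := by
      rw [← sub_eq_zero]
      exact hinj _ (by rw [map_sub, hm', sub_self])
    exact hh (hzero_of_mem h (h1 ▸ m.2))
  · have hMtop : M = ⊤ := hmin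
    have hObot : O = ⊥ := by rw [hO, hMtop]; exact isotropicPart_top hJ'
    have hnd : IsNondegenerate J' K₁ := by
      intro x hx horth
      have h1 : x = p (L ⟨x, hx⟩) := by
        have := hdiff ⟨x, hx⟩
        rw [hObot, Submodule.mem_bot, sub_eq_zero] at this
        exact this
      have h2 : T (L ⟨x, hx⟩) = 0 := by
        refine ext_inner_left ℂ fun g => ?_
        rw [← hpp, ← h1, hJ'.form_eq_zero_comm (horth _ (hpK g)), inner_zero_right]
      have h3 : L ⟨x, hx⟩ = 0 := by rw [← hST (L _), h2, map_zero]
      rw [h1, h3]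
      -- p is only a choice of limits, not known to be linear, so p 0 = 0 needs an argument.
      have h4 : p 0 ∈ O := by
        refine ⟨hpM 0, form_eq_zero_of_dense (E := defectVectors A' Γ' z₀) rfl ?_⟩
        rintro _ ⟨w, hw, g, rfl⟩
        refine (hpdef w hw g 0).trans ?_
        rw [map_zero, inner_zero_right]
      rwa [hObot, Submodule.mem_bot] at h4
    have hres0 : ∀ x ∈ K₁, ∀ v ∈ resSet A', res A' v x = 0 := by
      intro x hx v hv
      have := (mem_multivaluedPart.1 hx).2 v hv
      rw [← hM, ← hO, hObot] at this
      exact (Submodule.mem_bot ℂ).1 this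
    refine ⟨hnd, fun x hx y hxy => ?_⟩
    -- x lies in the range of a resolvent. That range is orthogonal to K₁, as the resolvents vanish
    -- on K₁, so non-degeneracy gives x = 0 and y ∈ Â(0).
    have hx0 : x = 0 := by
      refine hnd x hx fun x' hx' => ?_
      have h1 : y = (y - z₀ • x) + z₀ • x := by module
      have h2 : res A' z₀ (y - z₀ • x) = x := (res_spec h₀ _ _).1 (h1 ▸ hxy)
      rw [← h2, ← form_res_right hJ' hA' h₀, hres0 x' hx' _ (conj_mem_resSet hJ' hA' h₀),
        form_zero_right]
    rw [hx0] at hxy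
    refine mem_multivaluedPart.2 ⟨by rw [← hM, hMtop]; trivial, fun v hv => ?_⟩
    have h1 : res A' v y = 0 := (res_spec hv _ _).1 (by rwa [smul_zero, add_zero])
    rw [h1]
    exact Submodule.zero_mem _
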